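/- Let $N\ge 0$ and let $\ell=(\ell_{j,i})$ be the link capacities of a weighted graph on the $N+2$ nodes $0,1,\dots,N+1$ (node $0$ is the source, node $N+1$ the destination, nodes $1,\dots,N$ are relays, and $\ell_{j,i}$ is the capacity of the link from $i$ to $j$). Let P1 be the linear program in the variables $y=(F_{j,i},\lambda_{ij},\hat\lambda_{ij})$ with objective $\max\sum_{j=1}^{N+1}F_{j,0}$ and constraints (1a) $0\le F_{j,i}\le\lambda_{ji}\,\ell_{j,i}$ for all $(i,j)\in\{0,\dots,N\}\times\{1,\dots,N+1\}$; (1b) $\sum_{j\in\{1,\dots,N+1\}\setminus\{i\}}F_{j,i}=\sum_{k\in\{0,\dots,N\}\setminus\{i\}}F_{i,k}$ for all $i\in\{1,\dots,N\}$; (1c) $\hat\lambda_{ij}=\lambda_{ij}+\lambda_{ji}$ for all $0\le i<j\le N+1$; (1d) $\lambda_{ij}\ge 0$ for all $(i,j)\in\{0,\dots,N\}\times\{1,\dots,N+1\}$; (1e) $\sum_{i<j,\ i=v\text{ or }j=v}\hat\lambda_{ij}\le 1$ for all $v\in\{0,\dots,N+1\}$; (1f) $\sum_{i,j\in S,\ i<j}\hat\lambda_{ij}\le\frac{|S|-1}{2}$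 for all $S\subseteq\{0,\dots,N+1\}$ with $|S|$ odd; (1g) $\hat\lambda_{ij}\ge 0$ for all $0\le i<j\le N+1$. There is an algorithm (one algorithm for all $N$) that, given $N$, the real weights $\ell$ and a real point $y$ in the space of P1, decides whether $y$ is feasible in P1 and, if it is not, returns one of the constraints of P1 that is violated by $y$. Its running time is bounded by a polynomial in $N$. Here the running time is the number of elementary steps of a random-access machine on real data: reading and writing memory cells, additions, subtractions and comparisons of natural or real numbers, and multiplications of two input numbers. The violated constraint is returned as an inequality; when it comes from one of the equations (1b) or (1c), the violated direction is indicated. -/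

import Mathlib

/-! ## Real random-access programs with a step count

A small imperative language over a random-access memory that holds natural numbers (for counting
and addressing) and real numbers.  A program is a finite object, independent of the input, so an
algorithm is uniform in the size of its input.  Every primitive operation costs one step.

Natural numbers can be added, subtracted (truncated) and compared.  Real numbers can be added,
subtracted and compared, and two *input* numbers can be multiplied; the only real constants are
`0` and `1`.  Hence within `t` steps a program can only produce real numbers that are integer
combinations, with coefficients of `O(t)` bits, of `1`, the inputs and the products of two inputs:
no superpolynomial work can be hidden inside arithmetic of unit cost. -/

namespace RealRAM

/-- The read-only input: numbered two-dimensional arrays of real numbers. -/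
abbrev Input := ℕ → ℕ → ℕ → ℝ

/-- The read-write memory: numbered natural-number variables, numbered two-dimensional arrays of
natural numbers, and numbered two-dimensional arrays of real numbers. -/
structure State where
  var : ℕ → ℕ
  nat : ℕ → ℕ → ℕ → ℕ
  real : ℕ → ℕ → ℕ → ℝ

/-- Expressions with values in `ℕ`.  Names of variables and arrays are fixed in the program;
the two indices into an array are computed. -/
inductive NExp where
  | lit (n : ℕ)
  | var (x : ℕ)
  | get (a : ℕ) (i j : NExp)
  | add (e f : NExp)
  | sub (e f : NExp)

/-- Value of a natural-number expression. -/
def NExp.eval (s : State) : NExp → ℕ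
  | lit n => n
  | var x => s.var x
  | get a i j => s.nat a (i.eval s) (j.eval s)
  | add e f => e.eval s + f.eval s
  | sub e f => e.eval s - f.eval s

/-- Number of steps to evaluate a natural-number expression. -/
def NExp.cost : NExp → ℕ
  | lit _ => 1
  | var _ => 1
  | get _ i j => i.cost + j.cost + 1
  | add e f => e.cost + f.cost + 1
  | sub e f => e.cost + f.cost + 1

/-- Expressions with values in `ℝ`: the constants `0` and `1`, memory cells, input cells, products
of two input cells, sums and differences. -/
inductive RExp where
  | zero
  | one
  | get (a : ℕ) (i j : NExp)
  | inp (a : ℕ) (i j : NExp)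
  | inpMul (a : ℕ) (i j : NExp) (b : ℕ) (k l : NExp)
  | add (e f : RExp)
  | sub (e f : RExp)

/-- Value of a real expression. -/
def RExp.eval (I : Input) (s : State) : RExp → ℝ
  | zero => 0
  | one => 1
  | get a i j => s.real a (i.eval s) (j.eval s)
  | inp a i j => I a (i.eval s) (j.eval s)
  | inpMul a i j b k l => I a (i.eval s) (j.eval s) * I b (k.eval s) (l.eval s)
  | add e f => e.eval I s + f.eval I s
  | sub e f => e.eval I s - f.eval I s

/-- Number of steps to evaluate a real expression. -/
def RExp.cost : RExp → ℕ
  | zero => 1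
  | one => 1
  | get _ i j => i.cost + j.cost + 1
  | inp _ i j => i.cost + j.cost + 1
  | inpMul _ i j _ k l => i.cost + j.cost + k.cost + l.cost + 3
  | add e f => e.cost + f.cost + 1
  | sub e f => e.cost + f.cost + 1

/-- Tests: comparisons of natural numbers, comparisons of real numbers, negation, conjunction. -/
inductive BExp where
  | natLe (e f : NExp)
  | realLe (e f : RExp)
  | neg (b : BExp)
  | and (b c : BExp)

/-- Truth of a test. -/
def BExp.Holds (I : Input) (s : State) : BExp → Prop
  | natLe e f => e.eval s ≤ f.eval s
  | realLe e f => e.eval I s ≤ f.eval I s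
  | neg b => ¬ b.Holds I s
  | and b c => b.Holds I s ∧ c.Holds I s

/-- Number of steps to evaluate a test. -/
def BExp.cost : BExp → ℕ
  | natLe e f => e.cost + f.cost + 1
  | realLe e f => e.cost + f.cost + 1
  | neg b => b.cost + 1
  | and b c => b.cost + c.cost + 1

/-- Programs: `loop b c` is the loop "while `b` do `c`". -/
inductive Prog where
  | nop
  | setVar (x : ℕ) (e : NExp)
  | setNat (a : ℕ) (i j : NExp) (e : NExp)
  | setReal (a : ℕ) (i j : NExp) (e : RExp)
  | seq (c d : Prog)
  | cond (b : BExp) (c d : Prog)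
  | loop (b : BExp) (c : Prog)

/-- Write to a natural-number variable. -/
def State.putVar (s : State) (x v : ℕ) : State :=
  { s with var := fun y => if y = x then v else s.var y }

/-- Write to a cell of an array of natural numbers. -/
def State.putNat (s : State) (a i j v : ℕ) : State :=
  { s with nat := fun a' i' j' => if a' = a ∧ i' = i ∧ j' = j then v else s.nat a' i' j' }

/-- Write to a cell of an array of real numbers. -/
noncomputable def State.putReal (s : State) (a i j : ℕ) (v : ℝ) : State :=
  { s with real := fun a' i' j' => if a' = a ∧ i' = i ∧ j' = j then v else s.real a' i' j' }

/-- `Exec I c s t s'`: on input `I`, the program `c` started in memory `s` halts after exactly `t`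
steps in memory `s'`. -/
inductive Exec (I : Input) : Prog → State → ℕ → State → Prop where
  | nop (s : State) : Exec I .nop s 1 s
  | setVar (s : State) (x : ℕ) (e : NExp) :
      Exec I (.setVar x e) s (e.cost + 1) (s.putVar x (e.eval s))
  | setNat (s : State) (a : ℕ) (i j e : NExp) :
      Exec I (.setNat a i j e) s (i.cost + j.cost + e.cost + 1)
        (s.putNat a (i.eval s) (j.eval s) (e.eval s))
  | setReal (s : State) (a : ℕ) (i j : NExp) (e : RExp) :
      Exec I (.setReal a i j e) s (i.cost + j.cost + e.cost + 1)
        (s.putReal a (i.eval s) (j.eval s) (e.eval I s))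
  | seq {c d : Prog} {s s₁ s₂ : State} {t₁ t₂ : ℕ} :
      Exec I c s t₁ s₁ → Exec I d s₁ t₂ s₂ → Exec I (.seq c d) s (t₁ + t₂) s₂
  | condTrue {b : BExp} {c d : Prog} {s s₁ : State} {t : ℕ} :
      b.Holds I s → Exec I c s t s₁ → Exec I (.cond b c d) s (b.cost + 1 + t) s₁
  | condFalse {b : BExp} {c d : Prog} {s s₁ : State} {t : ℕ} :
      ¬ b.Holds I s → Exec I d s t s₁ → Exec I (.cond b c d) s (b.cost + 1 + t) s₁
  | loopTrue {b : BExp} {c : Prog} {s s₁ s₂ : State} {t₁ t₂ : ℕ} :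
      b.Holds I s → Exec I c s t₁ s₁ → Exec I (.loop b c) s₁ t₂ s₂ →
        Exec I (.loop b c) s (b.cost + 1 + t₁ + t₂) s₂
  | loopFalse {b : BExp} {c : Prog} {s : State} :
      ¬ b.Holds I s → Exec I (.loop b c) s (b.cost + 1) s

/-- Execution is deterministic: a program has at most one halting run on a given input. -/
theorem Exec.unique {I : Input} {c : Prog} {s s₁ s₂ : State} {t₁ t₂ : ℕ}
    (h₁ : Exec I c s t₁ s₁) (h₂ : Exec I c s t₂ s₂) : t₁ = t₂ ∧ s₁ = s₂ := by
  induction h₁ generalizing t₂ s₂ with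
  | nop => cases h₂; exact ⟨rfl, rfl⟩
  | setVar => cases h₂; exact ⟨rfl, rfl⟩
  | setNat => cases h₂; exact ⟨rfl, rfl⟩
  | setReal => cases h₂; exact ⟨rfl, rfl⟩
  | seq _ _ ih₁ ih₂ =>
    cases h₂ with
    | seq k₁ k₂ =>
      obtain ⟨rfl, rfl⟩ := ih₁ k₁
      obtain ⟨rfl, rfl⟩ := ih₂ k₂
      exact ⟨rfl, rfl⟩
  | condTrue hb _ ih =>
    cases h₂ with
    | condTrue _ k => obtain ⟨rfl, rfl⟩ := ih k; exact ⟨rfl, rfl⟩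
    | condFalse hb' _ => exact absurd hb hb'
  | condFalse hb _ ih =>
    cases h₂ with
    | condTrue hb' _ => exact absurd hb' hb
    | condFalse _ k => obtain ⟨rfl, rfl⟩ := ih k; exact ⟨rfl, rfl⟩
  | loopTrue hb _ _ ih₁ ih₂ =>
    cases h₂ with
    | loopTrue _ k₁ k₂ =>
      obtain ⟨rfl, rfl⟩ := ih₁ k₁
      obtain ⟨rfl, rfl⟩ := ih₂ k₂
      exact ⟨rfl, rfl⟩
    | loopFalse hb' => exact absurd hb hb'
  | loopFalse hb =>
    cases h₂ with
    | loopTrue hb' _ _ => exact absurd hb' hb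
    | loopFalse _ => exact ⟨rfl, rfl⟩

end RealRAM

/-! ## The linear program P1 of an `N`-relay half-duplex 1-2-1 network

The nodes are `0, …, N + 1`, that is `Fin (N + 2)`; `0` is the source, `N + 1` the destination. -/

namespace OneTwoOne

/-- The weighted graph of the network: `ell j i` is the capacity of the link from node `i` to
node `j`. -/
abbrev Network (N : ℕ) := Fin (N + 2) → Fin (N + 2) → ℝ

/-- A point in the space of P1: the flows `F j i` (from `i` to `j`), the activation times
`lam j i` (of the link from `i` to `j`) and the connection activation times `lamHat i j`.
Entries that occur in no constraint of P1 are irrelevant. -/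
structure Point (N : ℕ) where
  F : Fin (N + 2) → Fin (N + 2) → ℝ
  lam : Fin (N + 2) → Fin (N + 2) → ℝ
  lamHat : Fin (N + 2) → Fin (N + 2) → ℝ

/-- The constraints of P1, as inequalities (an equation is a pair of inequalities).
For `i j : Fin (N + 1)`, `i.castSucc` ranges over the nodes `0, …, N` and `j.succ` over the nodes
`1, …, N + 1`; for `i : Fin N`, `i.succ.castSucc` ranges over the relays `1, …, N`. -/
inductive Constraint (N : ℕ) where
  | flowNonneg (i j : Fin (N + 1))
  | flowLe (i j : Fin (N + 1))
  | conserveLe (i : Fin N)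
  | conserveGe (i : Fin N)
  | sumLe (i j : Fin (N + 2)) (h : i < j)
  | sumGe (i j : Fin (N + 2)) (h : i < j)
  | lamNonneg (i j : Fin (N + 1))
  | degree (v : Fin (N + 2))
  | oddSet (S : Finset (Fin (N + 2))) (h : Odd S.card)
  | lamHatNonneg (i j : Fin (N + 2)) (h : i < j)

/-- The flow out of relay `i`: the sum of `F j i` over the nodes `j ≠ i` other than the source. -/
noncomputable def Point.outflow {N : ℕ} (y : Point N) (i : Fin (N + 2)) : ℝ :=
  ∑ j : Fin (N + 2) with j ≠ 0 ∧ j ≠ i, y.F j i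

/-- The flow into relay `i`: the sum of `F i k` over the nodes `k ≠ i` other than the
destination. -/
noncomputable def Point.inflow {N : ℕ} (y : Point N) (i : Fin (N + 2)) : ℝ :=
  ∑ k : Fin (N + 2) with k ≠ Fin.last (N + 1) ∧ k ≠ i, y.F i k

/-- The point `y` satisfies a given constraint of P1 for the network `ell`. -/
def Constraint.Sat {N : ℕ} (ell : Network N) (y : Point N) : Constraint N → Prop
  | flowNonneg i j => 0 ≤ y.F j.succ i.castSucc
  | flowLe i j =>
      y.F j.succ i.castSucc ≤ y.lam j.succ i.castSucc * ell j.succ i.castSucc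
  | conserveLe i => y.outflow i.succ.castSucc ≤ y.inflow i.succ.castSucc
  | conserveGe i => y.inflow i.succ.castSucc ≤ y.outflow i.succ.castSucc
  | sumLe i j _ => y.lamHat i j ≤ y.lam i j + y.lam j i
  | sumGe i j _ => y.lam i j + y.lam j i ≤ y.lamHat i j
  | lamNonneg i j => 0 ≤ y.lam i.castSucc j.succ
  | degree v =>
      ∑ e : Fin (N + 2) × Fin (N + 2) with e.1 < e.2 ∧ (e.1 = v ∨ e.2 = v),
        y.lamHat e.1 e.2 ≤ 1
  | oddSet S _ =>
      ∑ e : Fin (N + 2) × Fin (N + 2) with e.1 < e.2 ∧ e.1 ∈ S ∧ e.2 ∈ S,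
        y.lamHat e.1 e.2 ≤ ((S.card : ℝ) - 1) / 2
  | lamHatNonneg i j _ => 0 ≤ y.lamHat i j

/-- The point `y` is feasible in P1. -/
def Feasible {N : ℕ} (ell : Network N) (y : Point N) : Prop :=
  ∀ c : Constraint N, c.Sat ell y

/-! ## Input and output conventions -/

/-- The input arrays: array `0` holds `ell`, array `1` holds `F`, array `2` holds `lam` and
array `3` holds `lamHat`. -/
noncomputable def input {N : ℕ} (ell : Network N) (y : Point N) : RealRAM.Input :=
  fun a i j =>
    if h : i < N + 2 ∧ j < N + 2 then
      match a with
      | 0 => ell ⟨i, h.1⟩ ⟨j, h.2⟩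
      | 1 => y.F ⟨i, h.1⟩ ⟨j, h.2⟩
      | 2 => y.lam ⟨i, h.1⟩ ⟨j, h.2⟩
      | 3 => y.lamHat ⟨i, h.1⟩ ⟨j, h.2⟩
      | _ => 0
    else 0

/-- The initial memory: variable `0` holds `N`, everything else is `0`. -/
def start (N : ℕ) : RealRAM.State where
  var := fun x => if x = 0 then N else 0
  nat := fun _ _ _ => 0
  real := fun _ _ _ => 0

/-- How a final memory is read as an answer.  Variable `0` is the kind of the answer: `0` means
"feasible" and `k > 0` the `k`-th kind of constraint.  Variables `1` and `2` hold the nodes that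
index the constraint; for an odd-set constraint, array `0` holds the indicator of the set. -/
def Answer {N : ℕ} (s : RealRAM.State) : Option (Constraint N) → Prop
  | none => s.var 0 = 0
  | some (.flowNonneg i j) => s.var 0 = 1 ∧ s.var 1 = i.castSucc.val ∧ s.var 2 = j.succ.val
  | some (.flowLe i j) => s.var 0 = 2 ∧ s.var 1 = i.castSucc.val ∧ s.var 2 = j.succ.val
  | some (.conserveLe i) => s.var 0 = 3 ∧ s.var 1 = i.succ.castSucc.val
  | some (.conserveGe i) => s.var 0 = 4 ∧ s.var 1 = i.succ.castSucc.val
  | some (.sumLe i j _) => s.var 0 = 5 ∧ s.var 1 = i.val ∧ s.var 2 = j.val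
  | some (.sumGe i j _) => s.var 0 = 6 ∧ s.var 1 = i.val ∧ s.var 2 = j.val
  | some (.lamNonneg i j) => s.var 0 = 7 ∧ s.var 1 = i.castSucc.val ∧ s.var 2 = j.succ.val
  | some (.degree v) => s.var 0 = 8 ∧ s.var 1 = v.val
  | some (.oddSet S _) =>
      s.var 0 = 9 ∧ ∀ v : Fin (N + 2), s.nat 0 v.val 0 = if v ∈ S then 1 else 0
  | some (.lamHatNonneg i j _) => s.var 0 = 10 ∧ s.var 1 = i.val ∧ s.var 2 = j.val

end OneTwoOne

/-! ## A program logic with step bounds -/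

/-! Apart from the odd-set constraints, P1 has only O(N²) constraints, each a comparison of entries
or of sums of O(N) of them; they are tested one at a time. The exponentially many odd-set
constraints are reduced to minimum odd cuts, following Padberg and Rao. Once the `lamHat i j` are
nonnegative and the degree constraints hold, join an extra vertex to every node `v` by an edge of
weight `1 - load v`. All weights are then nonnegative and every node has total weight 1, so the cut
of a node set `S` is `|S|` minus twice the weight inside `S` (`Point.cut_lift`). The constraint of
an odd `S` therefore says that its cut is at least 1. With parity weight 1 on the nodes and `N + 2`
on the extra vertex the total is even, so a set and its complement have the same parity, and a
cheapest set of odd weight decides all these constraints.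

By `exists_odd_isMinCut` such a set occurs among the inclusion-minimal minimum cuts `C a b`
(containing `a`, avoiding `b`) over all ordered pairs, so no cut tree is needed. Uncrossing makes
the relevant cuts nested or disjoint. Let `S₀` be a cheapest odd set of least cardinality and
suppose that all cuts `C a b` at most as expensive are even. For `b` outside `S₀`, if no `C a b`
with `a` in `S₀` contains `S₀`, these cuts meet `S₀` in even sets and laminarity makes `S₀` even.
Otherwise `C b a` lies outside `S₀` for some `a`. If this happens for every `b`, even laminar cuts
cover the complement, so the complement, and with it `S₀`, is even. Both cases are absurd.

The cuts are computed by push-relabel without returning excess to the source: when nothing moves,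
the vertices of label below the number of vertices form the minimal minimum cut around the sink
(`Inv.isMinCut`), and `potential` bounds the number of rounds polynomially.

The programs are verified for total correctness with `WP m`, where `m` bounds the rounds of every
single loop execution. For a fixed program the resulting step bound is a polynomial in `m`, and `m =
roundBound (N + 3)` is a polynomial in `N`. -/

namespace RealRAM

/-- A bound for the number of steps of a program none of whose loops makes more than `m` rounds. -/
def Prog.bound (m : ℕ) : Prog → ℕ
  | nop => 1
  | setVar _ e => e.cost + 1
  | setNat _ i j e => i.cost + j.cost + e.cost + 1
  | setReal _ i j e => i.cost + j.cost + e.cost + 1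
  | seq c d => c.bound m + d.bound m
  | cond b c d => b.cost + 1 + (c.bound m + d.bound m)
  | loop b c => m * (b.cost + 1 + c.bound m) + (b.cost + 1)

/-- A loop contributes one factor `m`, so the degree is at most the nesting depth of the program
text, which does not depend on the input. A conditional is charged for both branches to stay
polynomial. -/
theorem Prog.exists_polynomial_bound (c : Prog) :
    ∃ p : Polynomial ℕ, ∀ m, c.bound m = p.eval m := by
  induction c with
  | nop => exact ⟨1, by simp [bound]⟩
  | setVar x e => exact ⟨.C (e.cost + 1), fun m => by simp [bound]⟩
  | setNat a i j e => exact ⟨.C (i.cost + j.cost + e.cost + 1), fun m => by simp [bound]⟩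
  | setReal a i j e => exact ⟨.C (i.cost + j.cost + e.cost + 1), fun m => by simp [bound]⟩
  | seq c d hc hd =>
    obtain ⟨p, hp⟩ := hc
    obtain ⟨q, hq⟩ := hd
    exact ⟨p + q, fun m => by rw [bound, hp, hq, Polynomial.eval_add]⟩
  | cond b c d hc hd =>
    obtain ⟨p, hp⟩ := hc
    obtain ⟨q, hq⟩ := hd
    exact ⟨.C (b.cost + 1) + (p + q), fun m => by simp [bound, hp, hq]⟩
  | loop b c hc =>
    obtain ⟨p, hp⟩ := hc
    exact ⟨.X * (.C (b.cost + 1) + p) + .C (b.cost + 1), fun m => by simp [bound, hp]⟩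

/-- The program contains no assignment to the variable `x`. -/
def Prog.keepsVar (x : ℕ) : Prog → Bool
  | nop => true
  | setVar y _ => !(Nat.beq y x)
  | setNat _ _ _ _ => true
  | setReal _ _ _ _ => true
  | seq c d => c.keepsVar x && d.keepsVar x
  | cond _ c d => c.keepsVar x && d.keepsVar x
  | loop _ c => c.keepsVar x

/-- The program contains no assignment to the natural-number array `a`. -/
def Prog.keepsNat (a : ℕ) : Prog → Bool
  | nop => true
  | setVar _ _ => true
  | setNat b _ _ _ => !(Nat.beq b a)
  | setReal _ _ _ _ => true
  | seq c d => c.keepsNat a && d.keepsNat a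
  | cond _ c d => c.keepsNat a && d.keepsNat a
  | loop _ c => c.keepsNat a

/-- The program contains no assignment to the real array `a`. -/
def Prog.keepsReal (a : ℕ) : Prog → Bool
  | nop => true
  | setVar _ _ => true
  | setNat _ _ _ _ => true
  | setReal b _ _ _ => !(Nat.beq b a)
  | seq c d => c.keepsReal a && d.keepsReal a
  | cond _ c d => c.keepsReal a && d.keepsReal a
  | loop _ c => c.keepsReal a

/-- The memories `s` and `s'` agree on everything that `c` does not assign to. -/
structure Frame (c : Prog) (s s' : State) : Prop where
  var : ∀ x, c.keepsVar x = true → s'.var x = s.var x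
  nat : ∀ a, c.keepsNat a = true → s'.nat a = s.nat a
  real : ∀ a, c.keepsReal a = true → s'.real a = s.real a

theorem Frame.refl (c : Prog) (s : State) : Frame c s s :=
  ⟨fun _ _ => rfl, fun _ _ => rfl, fun _ _ => rfl⟩

theorem Frame.trans {c : Prog} {s₁ s₂ s₃ : State} (h : Frame c s₁ s₂) (h' : Frame c s₂ s₃) :
    Frame c s₁ s₃ :=
  ⟨fun x hx => (h'.var x hx).trans (h.var x hx), fun x hx => (h'.nat x hx).trans (h.nat x hx),
    fun x hx => (h'.real x hx).trans (h.real x hx)⟩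

theorem Frame.mono {c d : Prog} {s s' : State} (h : Frame c s s')
    (hv : ∀ x, d.keepsVar x = true → c.keepsVar x = true)
    (hn : ∀ x, d.keepsNat x = true → c.keepsNat x = true)
    (hr : ∀ x, d.keepsReal x = true → c.keepsReal x = true) : Frame d s s' :=
  ⟨fun x hx => h.var x (hv x hx), fun x hx => h.nat x (hn x hx), fun x hx => h.real x (hr x hx)⟩

@[simp] theorem State.putVar_var (s : State) (x v y : ℕ) :
    (s.putVar x v).var y = if y = x then v else s.var y := rfl
@[simp] theorem State.putVar_nat (s : State) (x v : ℕ) : (s.putVar x v).nat = s.nat := rfl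
@[simp] theorem State.putVar_real (s : State) (x v : ℕ) : (s.putVar x v).real = s.real := rfl
@[simp] theorem State.putNat_var (s : State) (a i j v : ℕ) :
    (s.putNat a i j v).var = s.var := rfl
@[simp] theorem State.putNat_nat (s : State) (a i j v a' i' j' : ℕ) :
    (s.putNat a i j v).nat a' i' j' = if a' = a ∧ i' = i ∧ j' = j then v else s.nat a' i' j' :=
  rfl
@[simp] theorem State.putNat_real (s : State) (a i j v : ℕ) :
    (s.putNat a i j v).real = s.real := rfl
@[simp] theorem State.putReal_var (s : State) (a i j : ℕ) (v : ℝ) :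
    (s.putReal a i j v).var = s.var := rfl
@[simp] theorem State.putReal_nat (s : State) (a i j : ℕ) (v : ℝ) :
    (s.putReal a i j v).nat = s.nat := rfl
@[simp] theorem State.putReal_real (s : State) (a i j : ℕ) (v : ℝ) (a' i' j' : ℕ) :
    (s.putReal a i j v).real a' i' j' =
      if a' = a ∧ i' = i ∧ j' = j then v else s.real a' i' j' := rfl

/-- The `keeps` tests are syntactic, so for a concrete program preservation of a variable or array
is proved by `rfl`. Loop invariants then need to mention only what the body changes. -/
theorem Exec.frame {I : Input} {c : Prog} {s s' : State} {t : ℕ} (h : Exec I c s t s') :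
    Frame c s s' := by
  induction h with
  | nop s => exact .refl _ _
  | setVar s x e =>
    refine ⟨fun y hy => ?_, fun _ _ => rfl, fun _ _ => rfl⟩
    have : y ≠ x := by rintro rfl; simp [Prog.keepsVar] at hy
    simp [this]
  | setNat s a i j e =>
    refine ⟨fun _ _ => rfl, fun b hb => ?_, fun _ _ => rfl⟩
    have : b ≠ a := by rintro rfl; simp [Prog.keepsNat] at hb
    funext k l
    simp [this]
  | setReal s a i j e =>
    refine ⟨fun _ _ => rfl, fun _ _ => rfl, fun b hb => ?_⟩
    have : b ≠ a := by rintro rfl; simp [Prog.keepsReal] at hb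
    funext k l
    simp [this]
  | seq _ _ h₁ h₂ =>
    exact (h₁.mono (by simp +contextual [Prog.keepsVar]) (by simp +contextual [Prog.keepsNat])
      (by simp +contextual [Prog.keepsReal])).trans (h₂.mono
      (by simp +contextual [Prog.keepsVar]) (by simp +contextual [Prog.keepsNat])
      (by simp +contextual [Prog.keepsReal]))
  | condTrue _ _ h =>
    exact h.mono (by simp +contextual [Prog.keepsVar]) (by simp +contextual [Prog.keepsNat])
      (by simp +contextual [Prog.keepsReal])
  | condFalse _ _ h =>
    exact h.mono (by simp +contextual [Prog.keepsVar]) (by simp +contextual [Prog.keepsNat])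
      (by simp +contextual [Prog.keepsReal])
  | loopTrue _ _ _ h₁ h₂ =>
    exact (h₁.mono (by simp [Prog.keepsVar]) (by simp [Prog.keepsNat])
      (by simp [Prog.keepsReal])).trans h₂
  | loopFalse _ => exact .refl _ _

/-- Started in `s`, the program `c` halts within `c.bound m` steps in a memory that satisfies
`Q`. -/
def WP (m : ℕ) (I : Input) (c : Prog) (s : State) (Q : State → Prop) : Prop :=
  ∃ t s', Exec I c s t s' ∧ t ≤ c.bound m ∧ Q s'

/-! ### Rules for total correctness with a step bound -/

section rules

variable {m : ℕ} {I : Input} {s : State} {Q R : State → Prop}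

theorem WP.imp {c : Prog} (h : WP m I c s R) (hQ : ∀ s', Frame c s s' → R s' → Q s') :
    WP m I c s Q := by
  obtain ⟨t, s', h₁, h₂, h₃⟩ := h
  exact ⟨t, s', h₁, h₂, hQ s' h₁.frame h₃⟩

theorem wp_nop (h : Q s) : WP m I .nop s Q := ⟨_, _, .nop s, le_rfl, h⟩

theorem wp_setVar {x : ℕ} {e : NExp} (h : Q (s.putVar x (e.eval s))) :
    WP m I (.setVar x e) s Q := ⟨_, _, .setVar s x e, le_rfl, h⟩

theorem wp_setNat {a : ℕ} {i j e : NExp} (h : Q (s.putNat a (i.eval s) (j.eval s) (e.eval s))) :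
    WP m I (.setNat a i j e) s Q := ⟨_, _, .setNat s a i j e, le_rfl, h⟩

theorem wp_setReal {a : ℕ} {i j : NExp} {e : RExp}
    (h : Q (s.putReal a (i.eval s) (j.eval s) (e.eval I s))) :
    WP m I (.setReal a i j e) s Q := ⟨_, _, .setReal s a i j e, le_rfl, h⟩

theorem wp_seq {c d : Prog} (h : WP m I c s fun s' => WP m I d s' Q) :
    WP m I (.seq c d) s Q := by
  obtain ⟨t, s', h₁, h₂, t', s'', h₃, h₄, h₅⟩ := h
  exact ⟨_, _, .seq h₁ h₃, Nat.add_le_add h₂ h₄, h₅⟩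

theorem wp_cond {b : BExp} {c d : Prog} (h₁ : b.Holds I s → WP m I c s Q)
    (h₂ : ¬ b.Holds I s → WP m I d s Q) : WP m I (.cond b c d) s Q := by
  by_cases hb : b.Holds I s
  · obtain ⟨t, s', h₁, h₂, h₃⟩ := h₁ hb
    exact ⟨_, _, .condTrue hb h₁, by rw [Prog.bound]; omega, h₃⟩
  · obtain ⟨t, s', h₁, h₂, h₃⟩ := h₂ hb
    exact ⟨_, _, .condFalse hb h₁, by rw [Prog.bound]; omega, h₃⟩

/-- The index of `J` is a variant: it drops in every round, possibly by more than one, so its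
initial value bounds the number of rounds. -/
theorem wp_loop {b : BExp} {c : Prog} {J : ℕ → State → Prop}
    (step : ∀ k s, J k s → b.Holds I s → WP m I c s fun s' => ∃ k' < k, J k' s')
    (done : ∀ k s, J k s → ¬ b.Holds I s → Q s) {k : ℕ} (hk : k ≤ m) (h : J k s) :
    WP m I (.loop b c) s Q := by
  -- At most `k` rounds, and one last test that fails.
  have main : ∀ k s, J k s → ∃ t s', Exec I (.loop b c) s t s' ∧
      t ≤ k * (b.cost + 1 + c.bound m) + (b.cost + 1) ∧ Q s' := by
    intro k
    induction k using Nat.strong_induction_on with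
    | _ k ih =>
      intro s hs
      by_cases hb : b.Holds I s
      · obtain ⟨t, s', h₁, h₂, k', hk', h₃⟩ := step k s hs hb
        obtain ⟨t', s'', h₄, h₅, h₆⟩ := ih k' hk' s' h₃
        refine ⟨_, _, .loopTrue hb h₁ h₄, ?_, h₆⟩
        have : (k' + 1) * (b.cost + 1 + c.bound m) ≤ k * (b.cost + 1 + c.bound m) :=
          Nat.mul_le_mul_right _ hk'
        rw [Nat.succ_mul] at this
        omega
      · exact ⟨_, _, .loopFalse hb, by omega, done k s hs hb⟩
  obtain ⟨t, s', h₁, h₂, h₃⟩ := main k s h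
  refine ⟨t, s', h₁, h₂.trans ?_, h₃⟩
  rw [Prog.bound]
  gcongr

/-- `e < f` -/
abbrev BExp.natLt (e f : NExp) : BExp := .natLe (.add e (.lit 1)) f

/-- `e < f` -/
abbrev BExp.realLt (e f : RExp) : BExp := .neg (.realLe f e)

/-- Run `c` with `x = 0, 1, …, b - 1`, where `x` and `b` are variables. -/
def Prog.forLoop (x b : ℕ) (c : Prog) : Prog :=
  .seq (.setVar x (.lit 0))
    (.loop (.natLt (.var x) (.var b)) (.seq c (.setVar x (.add (.var x) (.lit 1)))))

/-- The frame relative to the memory before the loop is carried along here once and for all, and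
handed to `step` and `done`. -/
theorem wp_forLoop {x b n : ℕ} {c : Prog} (J : ℕ → State → Prop) (hb : s.var b = n) (hn : n ≤ m)
    (hbk : (Prog.forLoop x b c).keepsVar b = true) (hx : c.keepsVar x = true)
    (init : J 0 (s.putVar x 0))
    (step : ∀ k s', k < n → s'.var x = k → Frame (.forLoop x b c) s s' → J k s' →
      WP m I c s' fun s'' => J (k + 1) (s''.putVar x (k + 1)))
    (done : ∀ s', Frame (.forLoop x b c) s s' → J n s' → Q s') :
    WP m I (.forLoop x b c) s Q := by
  have sub : ∀ y, (Prog.forLoop x b c).keepsVar y = true → c.keepsVar y = true ∧ y ≠ x := by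
    intro y hy
    simp only [Prog.forLoop, Prog.keepsVar, Bool.and_eq_true, Bool.not_eq_true'] at hy
    refine ⟨hy.2.1, ?_⟩
    rintro rfl
    simp at hy
  have put : ∀ s' k, Frame (.forLoop x b c) s' (s'.putVar x k) := by
    intro s' k
    refine ⟨fun y hy => ?_, fun _ _ => rfl, fun _ _ => rfl⟩
    simp [(sub y hy).2]
  refine wp_seq (wp_setVar ?_)
  -- The variant `k'` is the number of rounds that remain.
  refine wp_loop (J := fun k' s' => ∃ k, k + k' = n ∧ s'.var x = k ∧ J k s' ∧
    Frame (.forLoop x b c) s s') ?_ ?_ hn ⟨0, by simp, by simp [NExp.eval], init, put _ _⟩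
  · rintro k' s' ⟨k, hk, hxk, hJ, hF⟩ hlt
    simp only [BExp.Holds, NExp.eval, hF.var b hbk, hb, hxk] at hlt
    refine wp_seq ((step k s' (by omega) hxk hF hJ).imp fun s'' hF' hJ' => wp_setVar ?_)
    have hxk' : s''.var x = k := by rw [hF'.var x hx, hxk]
    refine ⟨n - (k + 1), by omega, k + 1, by omega, by simp [NExp.eval, hxk'], ?_, ?_⟩
    · simpa [NExp.eval, hxk'] using hJ'
    · refine (hF.trans (hF'.mono (fun y hy => (sub y hy).1) ?_ ?_)).trans (put _ _)
      · simp [Prog.forLoop, Prog.keepsNat]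
      · simp [Prog.forLoop, Prog.keepsReal]
  · rintro k' s' ⟨k, hk, hxk, hJ, hF⟩ hlt
    simp only [BExp.Holds, NExp.eval, hF.var b hbk, hb, hxk] at hlt
    obtain rfl : k = n := by omega
    exact done s' hF hJ

end rules

end RealRAM

/-! ## Minimum odd sets of symmetric submodular functions -/

namespace OddCut

variable {V : Type*} [Fintype V] [DecidableEq V]

/-- `C` is the inclusion-minimal set among the sets that minimize `f` and contain `a` but
not `b`. -/
structure IsMinCut (f : Finset V → ℝ) (a b : V) (C : Finset V) : Prop where
  left_mem : a ∈ C
  right_notMem : b ∉ C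
  le : ∀ Y, a ∈ Y → b ∉ Y → f C ≤ f Y
  subset : ∀ Y, a ∈ Y → b ∉ Y → f Y ≤ f C → C ⊆ Y

omit [Fintype V] in
/-- A family of sets indexed by the points of `S` that is laminar and covers `S`, each point lying in
its set, and each of whose members meets `S` in a set of even weight, forces `S` to be even. -/
theorem even_of_laminar_cover {τ : V → ℕ} {S : Finset V} (D : V → Finset V)
    (mem : ∀ a ∈ S, a ∈ D a)
    (nested : ∀ a ∈ S, ∀ c ∈ S, c ∈ D a → D c ⊆ D a)
    (disj : ∀ a ∈ S, ∀ c ∈ S, c ∉ D a → a ∉ D c → Disjoint (D a) (D c))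
    (even : ∀ a ∈ S, Even (∑ v ∈ D a ∩ S, τ v)) : Even (∑ v ∈ S, τ v) := by
  classical
  -- Induction over the subsets that contain the trace of each of their members: removing the trace
  -- of a member of largest cardinality leaves a subset of the same kind.
  have key : ∀ R ⊆ S, (∀ a ∈ R, D a ∩ S ⊆ R) → Even (∑ v ∈ R, τ v) := by
    intro R
    induction R using Finset.strongInduction with
    | H R ih =>
      intro hR hcl
      rcases R.eq_empty_or_nonempty with rfl | hne
      · simp
      · obtain ⟨a, ha, hmax⟩ := R.exists_max_image (fun a => (D a).card) hne
        have hsub := hcl a ha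
        have hss : R \ (D a ∩ S) ⊂ R := by
          refine Finset.sdiff_ssubset hsub ⟨a, ?_⟩
          simp [mem a (hR ha), hR ha]
        rw [← Finset.sum_sdiff hsub]
        refine (ih _ hss (hss.subset.trans hR) ?_).add (even a (hR ha))
        intro c hc x hx
        simp only [Finset.mem_sdiff, Finset.mem_inter, not_and] at hc hx ⊢
        have hcS := hR hc.1
        have hca : c ∉ D a := fun h => hc.2 h hcS
        refine ⟨hcl c hc.1 (by simp [hx]), fun hxa => ?_⟩
        -- Otherwise `D a ⊆ D c`, with equality because `D a` is largest, which would put `c` into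
        -- `D a`.
        have hac : a ∉ D c := by
          intro h
          have h₁ := nested c hcS a (hR ha) h
          have h₂ := Finset.eq_of_subset_of_card_le h₁ (hmax c hc.1)
          exact absurd (h₂ ▸ mem c hcS) hca
        exact absurd hx.1 (Finset.disjoint_left.1 (disj a (hR ha) c hcS hca hac) hxa)
  exact key S subset_rfl fun a _ => Finset.inter_subset_right

/-- If `f` is symmetric and submodular and the total weight is even, then the minimum of `f` over
the sets of odd weight is attained at an inclusion-minimal minimum cut between two points. -/
theorem exists_odd_isMinCut {f : Finset V → ℝ} (symm : ∀ A, f Aᶜ = f A)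
    (submod : ∀ A B, f (A ∩ B) + f (A ∪ B) ≤ f A + f B) {τ : V → ℕ} (total : Even (∑ v, τ v))
    {C : V → V → Finset V} (hC : ∀ a b, a ≠ b → IsMinCut f a b (C a b))
    {S : Finset V} (hS : Odd (∑ v ∈ S, τ v)) :
    ∃ a b, a ≠ b ∧ Odd (∑ v ∈ C a b, τ v) ∧ f (C a b) ≤ f S := by
  classical
  -- Submodularity for `A` and the complement of `B`, combined with symmetry.
  have posimod : ∀ A B, f (A \ B) + f (B \ A) ≤ f A + f B := by
    intro A B
    have h := submod A Bᶜ
    rw [symm B, ← symm (A ∪ Bᶜ)] at h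
    have h₁ : A ∩ Bᶜ = A \ B := by ext; simp
    have h₂ : (A ∪ Bᶜ)ᶜ = B \ A := by ext; simp [and_comm]
    rwa [h₁, h₂] at h
  -- The lexicographic order selects a set of least cardinality among the cheapest odd sets.
  obtain ⟨S₀, hS₀, hmin⟩ : ∃ S₀ : Finset V, Odd (∑ v ∈ S₀, τ v) ∧
      ∀ A, Odd (∑ v ∈ A, τ v) → toLex (f S₀, S₀.card) ≤ toLex (f A, A.card) := by
    obtain ⟨S₀, h, h'⟩ := (Finset.univ.filter fun A : Finset V => Odd (∑ v ∈ A, τ v)).exists_min_image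
      (fun A => toLex (f A, A.card)) ⟨S, by simpa using hS⟩
    exact ⟨S₀, by simpa using h, fun A hA => h' A (by simpa using hA)⟩
  have hopt : ∀ A, Odd (∑ v ∈ A, τ v) → f S₀ ≤ f A := by
    intro A hA
    rcases Prod.Lex.le_iff.1 (hmin A hA) with h | h
    · exact h.le
    · exact h.1.le
  have hcard : ∀ A, Odd (∑ v ∈ A, τ v) → f A ≤ f S₀ → S₀.card ≤ A.card := by
    intro A hA hle
    rcases Prod.Lex.le_iff.1 (hmin A hA) with h | h
    · exact absurd h hle.not_gt
    · exact h.2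
  have hle := hopt S hS
  clear hS hmin
  by_contra! hno
  have hev : ∀ a b, a ≠ b → f (C a b) ≤ f S₀ → Even (∑ v ∈ C a b, τ v) := by
    intro a b hab hf
    by_contra h
    exact absurd (hno a b hab (Nat.not_even_iff_odd.1 h)) (not_lt.2 (hf.trans hle))
  clear hno hle
  -- The union still separates `a` from `b`, so by submodularity the intersection is no dearer than
  -- `C c d`, and minimality of `C c d` applies.
  have nested : ∀ {a b c d}, a ≠ b → c ≠ d → c ∈ C a b → b ∉ C c d → d ∉ C a b →
      C c d ⊆ C a b := by
    intro a b c d hab hcd hc hb hd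
    have h₁ := (hC a b hab).le (C a b ∪ C c d) (by simp [(hC a b hab).left_mem])
      (by simp [(hC a b hab).right_notMem, hb])
    have h₂ := (hC c d hcd).subset (C a b ∩ C c d) (by simp [hc, (hC c d hcd).left_mem])
      (by simp [hd]) (by linarith [submod (C a b) (C c d)])
    exact h₂.trans Finset.inter_subset_left
  -- The same uncrossing with the two differences in place of intersection and union.
  have disj : ∀ {a b c d}, a ≠ b → c ≠ d → c ∉ C a b → a ∉ C c d → Disjoint (C a b) (C c d) := by
    intro a b c d hab hcd hc ha
    have h₁ := (hC c d hcd).le (C c d \ C a b) (by simp [hc, (hC c d hcd).left_mem])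
      (by simp [(hC c d hcd).right_notMem])
    have h₂ := (hC a b hab).subset (C a b \ C c d) (by simp [ha, (hC a b hab).left_mem])
      (by simp [(hC a b hab).right_notMem]) (by linarith [posimod (C a b) (C c d)])
    exact Finset.disjoint_left.2 fun x hx => (Finset.mem_sdiff.1 (h₂ hx)).2
  have ne : ∀ {a b}, a ∈ S₀ → b ∉ S₀ → a ≠ b := fun ha hb h => hb (h ▸ ha)
  -- If not, every `C a b` meets `S₀` in an even set. An odd trace would cost at most `f S₀`,
  -- because `C a b ∪ S₀` also separates `a` from `b`; least cardinality would then make the trace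
  -- all of `S₀`.
  have hall : ∀ b, b ∉ S₀ → ∃ a ∈ S₀, S₀ ⊆ C a b := by
    intro b hb
    by_contra! hcon
    refine Nat.not_even_iff_odd.2 hS₀ (even_of_laminar_cover (fun a => C a b)
      (fun a ha => (hC a b (ne ha hb)).left_mem) ?_ ?_ ?_)
    · intro a ha c hc hca
      exact nested (ne ha hb) (ne hc hb) hca (hC c b (ne hc hb)).right_notMem
        (hC a b (ne ha hb)).right_notMem
    · intro a ha c hc
      exact disj (ne ha hb) (ne hc hb)
    · intro a ha
      by_contra hodd
      rw [Nat.not_even_iff_odd] at hodd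
      have hm := hC a b (ne ha hb)
      have h₁ := hm.le (C a b ∪ S₀) (by simp [ha]) (by simp [hm.right_notMem, hb])
      have h₂ := hcard _ hodd (by linarith [submod (C a b) S₀])
      have h₃ := Finset.eq_of_subset_of_card_le Finset.inter_subset_right h₂
      exact hcon a ha (h₃ ▸ Finset.inter_subset_left)
  choose! a ha hsub using hall
  have ne' : ∀ {b}, b ∉ S₀ → b ≠ a b := fun hb => (ne (ha _ hb) hb).symm
  -- By symmetry the complement of `C (a b) b` is a cheapest set around `b` avoiding `a b`, so it
  -- contains the minimal one; and it misses `S₀`.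
  have hdis : ∀ b, b ∉ S₀ → C b (a b) ⊆ S₀ᶜ := by
    intro b hb
    have h₁ := hC (a b) b (ne' hb).symm
    have h₂ := hC b (a b) (ne' hb)
    refine (h₂.subset (C (a b) b)ᶜ (by simp [h₁.right_notMem]) (by simp [h₁.left_mem]) ?_).trans
      (Finset.compl_subset_compl.2 (hsub b hb))
    rw [symm]
    have := h₁.le (C b (a b))ᶜ (by simp [h₂.right_notMem]) (by simp [h₂.left_mem])
    rwa [symm] at this
  -- The cuts `C b (a b)` cover the complement laminarly. Each costs at most `f S₀ᶜ = f S₀`, hence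
  -- is even by `hev`.
  have hcompl : Even (∑ v ∈ S₀ᶜ, τ v) := by
    have avoid : ∀ b d, b ∉ S₀ → d ∉ S₀ → a d ∉ C b (a b) := fun b d hb hd h =>
      Finset.mem_compl.1 (hdis b hb h) (ha d hd)
    refine even_of_laminar_cover (fun b => C b (a b)) ?_ ?_ ?_ ?_ <;>
      simp only [Finset.mem_compl]
    · exact fun b hb => (hC b (a b) (ne' hb)).left_mem
    · exact fun b hb c hc hcb => nested (ne' hb) (ne' hc) hcb (avoid c b hc hb) (avoid b c hb hc)
    · exact fun b hb c hc => disj (ne' hb) (ne' hc)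
    · intro b hb
      rw [Finset.inter_eq_left.2 (hdis b hb)]
      refine hev b (a b) (ne' hb) ?_
      have := (hC b (a b) (ne' hb)).le S₀ᶜ (by simpa using hb) (by simpa using ha b hb)
      rwa [symm] at this
  rw [← Finset.sum_add_sum_compl S₀ τ] at total
  exact Nat.not_even_iff_odd.2 hS₀ ((Nat.even_add.1 total).2 hcompl)

/-- The weight of the edges that leave `A`. -/
def cut (w : V → V → ℝ) (A : Finset V) : ℝ := ∑ u ∈ A, ∑ v ∈ Aᶜ, w u v

/-- Summing over all ordered pairs lets submodularity be checked pair by pair. -/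
theorem cut_eq (w : V → V → ℝ) (A : Finset V) :
    cut w A = ∑ u, ∑ v, if u ∈ A ∧ v ∉ A then w u v else 0 := by
  classical
  rw [cut, ← Finset.sum_subset (Finset.subset_univ A)]
  · refine Finset.sum_congr rfl fun u hu => ?_
    rw [← Finset.sum_subset (Finset.subset_univ Aᶜ)]
    · exact Finset.sum_congr rfl fun v hv => by simp [hu, Finset.mem_compl.1 hv]
    · intro v _ hv
      simp_all
  · intro u _ hu
    simp [hu]

theorem cut_compl {w : V → V → ℝ} (hw : ∀ u v, w u v = w v u) (A : Finset V) :
    cut w Aᶜ = cut w A := by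
  rw [cut, cut, compl_compl, Finset.sum_comm]
  exact Finset.sum_congr rfl fun u _ => Finset.sum_congr rfl fun v _ => hw v u

theorem cut_submodular {w : V → V → ℝ} (hw : ∀ u v, 0 ≤ w u v) (A B : Finset V) :
    cut w (A ∩ B) + cut w (A ∪ B) ≤ cut w A + cut w B := by
  simp only [cut_eq, ← Finset.sum_add_distrib]
  refine Finset.sum_le_sum fun u _ => Finset.sum_le_sum fun v _ => ?_
  have := hw u v
  by_cases h₁ : u ∈ A <;> by_cases h₂ : u ∈ B <;> by_cases h₃ : v ∈ A <;> by_cases h₄ : v ∈ B <;>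
    simp [h₁, h₂, h₃, h₄, this]

end OddCut

/-! ## Minimum cuts by pushing and relabelling -/

namespace PushRelabel

open OddCut

variable {V : Type*} [Fintype V] [DecidableEq V]

/-- `c` is the residual capacity, `e` the excess and `d` the label of a preflow from `s` in the
undirected graph with weights `w`, for which `d` is a valid labelling towards `t`. -/
structure Inv (w : V → V → ℝ) (s t : V) (c : V → V → ℝ) (e : V → ℝ) (d : V → ℕ) : Prop where
  residual_nonneg : ∀ u v, 0 ≤ c u v
  residual_add : ∀ u v, c u v + c v u = w u v + w v u
  excess_eq : ∀ v, v ≠ s → e v = ∑ u, (w u v - c u v)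
  excess_nonneg : ∀ v, v ≠ s → 0 ≤ e v
  source : d s = Fintype.card V
  sink : d t = 0
  label_le : ∀ v, d v ≤ Fintype.card V
  valid : ∀ u v, 0 < c u v → d u ≤ d v + 1

open Classical in
/-- A measure that decreases with every push and every relabelling. -/
noncomputable def potential (c : V → V → ℝ) (e : V → ℝ) (d : V → ℕ) : ℕ :=
  ((Fintype.card V + 1) * Fintype.card V + 2) * ∑ u, (Fintype.card V - d u) +
    (Fintype.card V + 1) * (∑ u, ∑ v, if 0 < c u v ∨ d u ≤ d v then 1 else 0) +
    ∑ u, if 0 < e u then d u else 0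

omit [DecidableEq V] in
theorem potential_le (c : V → V → ℝ) (e : V → ℝ) (d : V → ℕ) (hd : ∀ v, d v ≤ Fintype.card V) :
    potential c e d ≤ ((Fintype.card V + 1) * Fintype.card V + 2) * Fintype.card V ^ 2 +
      (Fintype.card V + 1) * Fintype.card V ^ 2 + Fintype.card V ^ 2 := by
  rw [potential]
  have h : ∀ f : V → ℕ, (∀ v, f v ≤ Fintype.card V) → ∑ v, f v ≤ Fintype.card V ^ 2 := by
    intro f hf
    refine (Finset.sum_le_card_nsmul _ _ _ fun v _ => hf v).trans ?_
    simp [sq]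
  gcongr
  · exact h _ fun v => Nat.sub_le _ _
  · refine h _ fun u => (Finset.sum_le_card_nsmul _ _ 1 fun v _ => ?_).trans (by simp)
    split_ifs <;> simp
  · refine h _ fun v => ?_
    split_ifs
    · exact hd v
    · exact Nat.zero_le _

/-- The residual capacities after pushing `δ` from `u` to `v`. -/
def pushResidual (c : V → V → ℝ) (u v : V) (δ : ℝ) : V → V → ℝ := fun x y =>
  if x = u ∧ y = v then c u v - δ else if x = v ∧ y = u then c v u + δ else c x y

/-- The excesses after pushing `δ` from `u` to `v`. -/
def pushExcess (e : V → ℝ) (u v : V) (δ : ℝ) : V → ℝ := fun x =>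
  if x = u then e u - δ else if x = v then e v + δ else e x

/-- The labels after relabelling `u`. -/
def relabel (d : V → ℕ) (u : V) : V → ℕ := fun x => if x = u then d u + 1 else d x

variable {w c : V → V → ℝ} {s t u v : V} {e : V → ℝ} {d : V → ℕ} {δ : ℝ}

/-- The saturation of the edges at `s` starts the algorithm. -/
theorem Inv.init (hw : ∀ u v, 0 ≤ w u v) (hw₀ : ∀ u, w u u = 0) (hst : s ≠ t) :
    Inv w s t (fun u v => if u = s then 0 else if v = s then w u v + w v u else w u v)
      (fun v => w s v) (fun v => if v = s then Fintype.card V else 0) where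
  residual_nonneg u v := by
    have := hw u v
    have := hw v u
    split_ifs <;> linarith
  residual_add u v := by
    split_ifs with h₁ h₂ h₂
    · simp [h₁, h₂, hw₀]
    · ring
    · ring
    · rfl
  excess_eq v hv := by
    have : ∀ u, (w u v - if u = s then 0 else if v = s then w u v + w v u else w u v) =
        if u = s then w s v else 0 := by
      intro u
      by_cases h : u = s <;> simp [h, hv]
    simp [this]
  excess_nonneg v _ := hw s v
  source := by simp
  sink := by simp [hst.symm]
  label_le v := by split_ifs <;> simp
  valid u v h := by
    by_cases hu : u = s
    · simp [hu] at h
    · simp [hu]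

omit [DecidableEq V] in
theorem Inv.ne_source (h : Inv w s t c e d) (hu : d u < Fintype.card V) : u ≠ s := by
  rintro rfl
  exact hu.ne h.source

/-- Only the reverse arc can become residual, and it leads from the lower label to the higher one,
so the labelling stays valid. -/
theorem Inv.push (h : Inv w s t c e d) (hu : d u < Fintype.card V) (huv : d u = d v + 1)
    (h₀ : 0 ≤ δ) (he : δ ≤ e u) (hc : δ ≤ c u v) :
    Inv w s t (pushResidual c u v δ) (pushExcess e u v δ) d where
  residual_nonneg x y := by
    have h₁ := h.residual_nonneg x y
    have h₂ := h.residual_nonneg v u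
    rw [pushResidual]
    split_ifs <;> linarith
  residual_add x y := by
    have hne : u ≠ v := by rintro rfl; omega
    rw [← h.residual_add x y, pushResidual, pushResidual]
    by_cases h₁ : x = u ∧ y = v
    · obtain ⟨rfl, rfl⟩ := h₁
      simp [hne]
    · by_cases h₂ : x = v ∧ y = u
      · obtain ⟨rfl, rfl⟩ := h₂
        simp [hne.symm]
      · have h₃ : ¬ (y = u ∧ x = v) := fun h => h₂ h.symm
        have h₄ : ¬ (y = v ∧ x = u) := fun h => h₁ h.symm
        simp [h₁, h₂, h₃, h₄]
  excess_eq y hy := by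
    have hne : u ≠ v := by rintro rfl; omega
    -- The flow into `y` changes only along the pushed arc (by `δ` at `v`) and along its reverse (by
    -- `-δ` at `u`).
    have key : ∀ x, w x y - pushResidual c u v δ x y = (w x y - c x y) +
        ((if x = u then (if y = v then δ else 0) else 0) -
          (if x = v then (if y = u then δ else 0) else 0)) := by
      intro x
      rw [pushResidual]
      by_cases h₁ : x = u
      · subst h₁
        by_cases h₂ : y = v
        · subst h₂
          simp [hne]
          ring
        · simp [h₂, hne]
      · by_cases h₂ : x = v
        · subst h₂
          by_cases h₃ : y = u
          · subst h₃
            simp [h₁]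
            ring
          · simp [h₁, h₃]
        · simp [h₁, h₂]
    simp only [key, Finset.sum_add_distrib, Finset.sum_sub_distrib, Finset.sum_ite_eq',
      Finset.mem_univ, if_true]
    rw [← Finset.sum_sub_distrib, ← h.excess_eq y hy, pushExcess]
    by_cases h₁ : y = u
    · subst h₁
      simp [hne]
      ring
    · by_cases h₂ : y = v
      · subst h₂
        simp [h₁]
      · simp [h₁, h₂]
  excess_nonneg x hx := by
    have h₁ := h.excess_nonneg x hx
    rw [pushExcess]
    split_ifs with h₂ h₃
    · linarith
    · subst h₃
      linarith
    · exact h₁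
  source := h.source
  sink := h.sink
  label_le := h.label_le
  valid x y hxy := by
    by_cases h₁ : x = u ∧ y = v
    · rw [h₁.1, h₁.2]
      omega
    · by_cases h₂ : x = v ∧ y = u
      · rw [h₂.1, h₂.2]
        omega
      · rw [pushResidual, if_neg h₁, if_neg h₂] at hxy
        exact h.valid x y hxy

-- Corrections on both sides record gains and losses without truncated subtraction.
omit [DecidableEq V] in
theorem sum_add_le_sum_add {f g : V → ℕ} (p q : V → ℕ) (h : ∀ x, f x + p x ≤ g x + q x) :
    ∑ x, f x + ∑ x, p x ≤ ∑ x, g x + ∑ x, q x := by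
  rw [← Finset.sum_add_distrib, ← Finset.sum_add_distrib]
  exact Finset.sum_le_sum fun x _ => h x

/-- A saturating push removes the pair `(u, v)` from the count in the middle term and adds none,
since the reverse pair is counted already by its labels. This saves `card V + 1`, while the last
term grows by at most `card V`. A push that is not saturating exhausts the excess of `u`: the last
term loses `d u` and gains at most `d v = d u - 1`. -/
theorem Inv.potential_push (h : Inv w s t c e d) (hu : d u < Fintype.card V)
    (huv : d u = d v + 1) (h₀ : 0 < δ) (he : δ ≤ e u) (hc : δ ≤ c u v)
    (hδ : δ = e u ∨ δ = c u v) :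
    potential (pushResidual c u v δ) (pushExcess e u v δ) d < potential c e d := by
  classical
  have hne : u ≠ v := by rintro rfl; omega
  have hcu : 0 < c u v := h₀.trans_le hc
  have heu : 0 < e u := h₀.trans_le he
  have edges : ∀ x y, (if 0 < pushResidual c u v δ x y ∨ d x ≤ d y then 1 else 0) ≤
      (if 0 < c x y ∨ d x ≤ d y then 1 else 0) := by
    intro x y
    have : 0 < pushResidual c u v δ x y ∨ d x ≤ d y → 0 < c x y ∨ d x ≤ d y := by
      rintro (h | h)
      · by_cases h₁ : x = u ∧ y = v
        · rw [h₁.1, h₁.2]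
          exact Or.inl hcu
        · by_cases h₂ : x = v ∧ y = u
          · rw [h₂.1, h₂.2]
            exact Or.inr (by omega)
          · rw [pushResidual, if_neg h₁, if_neg h₂] at h
            exact Or.inl h
      · exact Or.inr h
    split_ifs with h₁ h₂ <;> first | exact absurd (this h₁) h₂ | simp
  rw [potential, potential]
  rcases eq_or_ne δ (c u v) with hs | hs
  · have h₁ : (∑ x, ∑ y, if 0 < pushResidual c u v δ x y ∨ d x ≤ d y then 1 else 0) + 1 ≤
        ∑ x, ∑ y, if 0 < c x y ∨ d x ≤ d y then 1 else 0 := by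
      have := sum_add_le_sum_add
        (f := fun x => ∑ y, if 0 < pushResidual c u v δ x y ∨ d x ≤ d y then 1 else 0)
        (g := fun x => ∑ y, if 0 < c x y ∨ d x ≤ d y then 1 else 0)
        (fun x => if x = u then 1 else 0) (fun _ => 0) ?_
      · simpa using this
      · intro x
        by_cases hx : x = u
        · subst hx
          have := sum_add_le_sum_add
            (f := fun y => if 0 < pushResidual c x v δ x y ∨ d x ≤ d y then 1 else 0)
            (g := fun y => if 0 < c x y ∨ d x ≤ d y then 1 else 0)
            (fun y => if y = v then 1 else 0) (fun _ => 0) ?_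
          · simpa using this
          · intro y
            by_cases hy : y = v
            · subst hy
              simp [pushResidual, hs, hcu, huv]
            · simpa [hy] using edges x y
        · simpa [hx] using Finset.sum_le_sum fun y _ => edges x y
    have h₂ : (∑ x, if 0 < pushExcess e u v δ x then d x else 0) ≤
        (∑ x, if 0 < e x then d x else 0) + Fintype.card V := by
      have := sum_add_le_sum_add
        (f := fun x => if 0 < pushExcess e u v δ x then d x else 0)
        (g := fun x => if 0 < e x then d x else 0)
        (fun _ => 0) (fun x => if x = v then Fintype.card V else 0) ?_
      · simpa using this
      · intro x
        have hl := h.label_le x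
        by_cases hx : x = v
        · subst hx
          simp only [if_true, add_zero]
          split_ifs <;> omega
        · by_cases hxu : x = u
          · subst hxu
            simp only [heu, if_true, hx, if_false, add_zero]
            split_ifs <;> omega
          · simp [hx, hxu, pushExcess]
    have h₃ := Nat.mul_le_mul_left (Fintype.card V + 1) h₁
    rw [Nat.mul_add] at h₃
    omega
  · have hδe : δ = e u := hδ.resolve_right hs
    have h₁ : (∑ x, ∑ y, if 0 < pushResidual c u v δ x y ∨ d x ≤ d y then 1 else 0) ≤
        ∑ x, ∑ y, if 0 < c x y ∨ d x ≤ d y then 1 else 0 :=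
      Finset.sum_le_sum fun x _ => Finset.sum_le_sum fun y _ => edges x y
    have h₂ := sum_add_le_sum_add
        (f := fun x => if 0 < pushExcess e u v δ x then d x else 0)
        (g := fun x => if 0 < e x then d x else 0)
        (fun x => if x = u then d u else 0) (fun x => if x = v then d v else 0) (by
          intro x
          by_cases hx : x = v
          · subst hx
            simp only [if_true, hne.symm, if_false]
            split_ifs <;> omega
          · by_cases hxu : x = u
            · subst hxu
              simp [heu, hx, pushExcess, hδe]
            · simp [hx, hxu, pushExcess])
    simp only [Finset.sum_ite_eq', Finset.mem_univ, if_true] at h₂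
    have h₃ := Nat.mul_le_mul_left (Fintype.card V + 1) h₁
    omega

/-- A residual arc out of `u` that is not admissible has `d u ≤ d v`, which leaves room for one
unit. -/
theorem Inv.relabel (h : Inv w s t c e d) (hu : d u < Fintype.card V) (hut : u ≠ t)
    (hadm : ∀ v, 0 < c u v → d u ≠ d v + 1) : Inv w s t c e (relabel d u) where
  residual_nonneg := h.residual_nonneg
  residual_add := h.residual_add
  excess_eq := h.excess_eq
  excess_nonneg := h.excess_nonneg
  source := by simp [PushRelabel.relabel, (h.ne_source hu).symm, h.source]
  sink := by simp [PushRelabel.relabel, hut.symm, h.sink]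
  label_le x := by
    have := h.label_le x
    rw [PushRelabel.relabel]
    split_ifs <;> omega
  valid x y hxy := by
    have h₁ := h.valid x y hxy
    rw [PushRelabel.relabel, PushRelabel.relabel]
    split_ifs with hx hy hy
    · omega
    · subst hx
      have := hadm y hxy
      omega
    · subst hy
      omega
    · exact h₁

/-- The only pairs newly counted are of the form `(x, u)`, at most `card V` of them, and the last
term grows by at most 1. The coefficient `(card V + 1) * card V + 2` of the first term exceeds this
total by one. -/
theorem potential_relabel (hu : d u < Fintype.card V) :
    potential c e (relabel d u) < potential c e d := by
  classical
  rw [potential, potential]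
  have h₁ := sum_add_le_sum_add (f := fun x => Fintype.card V - relabel d u x)
    (g := fun x => Fintype.card V - d x) (fun x => if x = u then 1 else 0) (fun _ => 0) (by
      intro x
      by_cases hx : x = u
      · subst hx
        simp only [relabel, if_true]
        omega
      · simp [relabel, hx])
  have h₂ := sum_add_le_sum_add
    (f := fun x => ∑ y, if 0 < c x y ∨ relabel d u x ≤ relabel d u y then 1 else 0)
    (g := fun x => ∑ y, if 0 < c x y ∨ d x ≤ d y then 1 else 0)
    (fun _ => 0) (fun _ => 1) (by
      intro x
      have := sum_add_le_sum_add
        (f := fun y => if 0 < c x y ∨ relabel d u x ≤ relabel d u y then 1 else 0)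
        (g := fun y => if 0 < c x y ∨ d x ≤ d y then 1 else 0)
        (fun _ => 0) (fun y => if y = u then 1 else 0) (by
          intro y
          by_cases hy : y = u
          · simp only [hy, if_true]
            split_ifs <;> simp
          · have : relabel d u x ≤ d y → d x ≤ d y := by
              rw [relabel]
              split_ifs with hx
              · subst hx
                omega
              · exact id
            have h' : relabel d u y = d y := by simp [relabel, hy]
            rw [h']
            simp only [hy, if_false, add_zero]
            split_ifs with h₁ h₂ <;> first | exact absurd (h₁.imp_right this) h₂ | simp)
      simpa using this)
  have h₃ := sum_add_le_sum_add
    (f := fun x => if 0 < e x then relabel d u x else 0)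
    (g := fun x => if 0 < e x then d x else 0) (fun _ => 0) (fun x => if x = u then 1 else 0) (by
      intro x
      by_cases hx : x = u
      · subst hx
        simp only [relabel, if_true]
        split_ifs <;> omega
      · simp [relabel, hx])
  simp only [Finset.sum_ite_eq', Finset.mem_univ, if_true, Finset.sum_const_zero, add_zero,
    Finset.sum_const, smul_eq_mul, mul_one, Finset.card_univ] at h₁ h₂ h₃
  have h₄ := Nat.mul_le_mul_left (Fintype.card V + 1) h₂
  have h₅ := Nat.mul_le_mul_left ((Fintype.card V + 1) * Fintype.card V + 2) h₁
  rw [Nat.mul_add] at h₄ h₅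
  omega

/-- The excess of a set is what the cut carries into it. -/
theorem Inv.sum_excess (h : Inv w s t c e d) (hw : ∀ u v, w u v = w v u) {Y : Finset V}
    (hs : s ∉ Y) : ∑ v ∈ Y, e v = cut w Y - ∑ v ∈ Y, ∑ u ∈ Yᶜ, c u v := by
  have h₁ : ∑ v ∈ Y, e v = ∑ v ∈ Y, ∑ u, (w u v - c u v) :=
    Finset.sum_congr rfl fun v hv => h.excess_eq v fun hvs => hs (hvs ▸ hv)
  -- Net flow is antisymmetric by `residual_add`, so it cancels inside `Y`.
  have h₂ : ∑ v ∈ Y, ∑ u ∈ Y, (w u v - c u v) = 0 := by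
    have h₃ : ∑ v ∈ Y, ∑ u ∈ Y, (w u v - c u v) = -∑ v ∈ Y, ∑ u ∈ Y, (w u v - c u v) := by
      conv_lhs => rw [Finset.sum_comm]
      rw [← Finset.sum_neg_distrib]
      refine Finset.sum_congr rfl fun v _ => ?_
      rw [← Finset.sum_neg_distrib]
      refine Finset.sum_congr rfl fun u _ => ?_
      linarith [h.residual_add u v]
    linarith
  rw [h₁, cut, ← Finset.sum_sub_distrib]
  simp_rw [← Finset.sum_add_sum_compl Y, Finset.sum_add_distrib]
  rw [h₂, zero_add]
  refine Finset.sum_congr rfl fun v _ => ?_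
  rw [← Finset.sum_sub_distrib]
  exact Finset.sum_congr rfl fun u _ => by rw [hw]

/-- When nothing can be pushed or relabelled, the points with small label form the minimal
minimum cut around the sink. -/
theorem Inv.isMinCut (h : Inv w s t c e d) (hw : ∀ u v, w u v = w v u)
    (hpush : ∀ u v, d u < Fintype.card V → 0 < c u v → d u = d v + 1 → e u ≤ 0)
    (hrel : ∀ u, u ≠ t → d u < Fintype.card V → ∃ v, 0 < c u v ∧ d u = d v + 1) :
    IsMinCut (cut w) t s (Finset.univ.filter fun v => d v < Fintype.card V) := by
  set X := Finset.univ.filter fun v => d v < Fintype.card V with hX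
  have hsX : s ∉ X := by simp [hX, h.source]
  have htX : t ∈ X := by
    simp only [hX, Finset.mem_filter, Finset.mem_univ, true_and, h.sink]
    exact Fintype.card_pos_iff.2 ⟨t⟩
  -- Following admissible arcs down from `u` meets every smaller label.
  have chain : ∀ k u, d u = k → k < Fintype.card V → ∀ j ≤ k, ∃ v, d v = j := by
    intro k
    induction k with
    | zero => exact fun u hu _ j hj => ⟨u, by omega⟩
    | succ k ih =>
      intro u hu hk j hj
      rcases hj.lt_or_eq with hj | rfl
      · obtain ⟨v, _, hv⟩ := hrel u (by rintro rfl; rw [h.sink] at hu; omega) (by omega)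
        exact ih v (by omega) (by omega) j (by omega)
      · exact ⟨u, hu⟩
  -- Label `card V - 1` cannot occur: all labels below `card V` would then be taken by the `card V -
  -- 1` vertices other than the source. By validity no residual arc enters `X` from outside.
  have gap : ∀ u, d u < Fintype.card V → d u + 1 < Fintype.card V := by
    intro u hu
    by_contra hcon
    have hsurj : Set.SurjOn d (Finset.univ.erase s : Finset V)
        (Finset.range (Fintype.card V) : Finset ℕ) := by
      intro j hj
      rw [Finset.mem_coe, Finset.mem_range] at hj
      obtain ⟨v, hv⟩ := chain _ u rfl hu j (by omega)
      refine ⟨v, ?_, hv⟩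
      simp only [Finset.coe_erase, Finset.coe_univ, Set.mem_sdiff, Set.mem_univ,
        Set.mem_singleton_iff, true_and]
      rintro rfl
      rw [h.source] at hv
      omega
    have := Finset.card_le_card_of_surjOn d hsurj
    rw [Finset.card_range, Finset.card_erase_of_mem (Finset.mem_univ s), Finset.card_univ] at this
    omega
  have hcross : ∑ v ∈ X, ∑ u ∈ Xᶜ, c u v = 0 := by
    refine Finset.sum_eq_zero fun v hv => Finset.sum_eq_zero fun u hu => ?_
    simp only [hX, Finset.mem_compl, Finset.mem_filter, Finset.mem_univ, true_and] at hu hv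
    by_contra hne
    have h₁ := h.valid u v (lt_of_le_of_ne (h.residual_nonneg u v) (Ne.symm hne))
    have h₂ := gap v hv
    omega
  have hcutX : cut w X = e t := by
    have h₁ := h.sum_excess hw hsX
    rw [hcross, sub_zero] at h₁
    rw [← h₁]
    refine Finset.sum_eq_single_of_mem t htX fun v hv hvt => ?_
    simp only [hX, Finset.mem_filter, Finset.mem_univ, true_and] at hv
    obtain ⟨x, hx, hx'⟩ := hrel v hvt hv
    exact le_antisymm (hpush v x hv hx hx') (h.excess_nonneg v (h.ne_source hv))
  have hcross_nonneg : ∀ Y : Finset V, ∀ v ∈ Y, 0 ≤ ∑ u ∈ Yᶜ, c u v := fun Y v _ =>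
    Finset.sum_nonneg fun u _ => h.residual_nonneg u v
  -- The excess inside `Y` is at least that of the sink, which equals the cut of `X`.
  have hY : ∀ Y, t ∈ Y → s ∉ Y → cut w X + ∑ v ∈ Y, ∑ u ∈ Yᶜ, c u v ≤ cut w Y := by
    intro Y ht hs
    have h₁ := h.sum_excess hw hs
    have h₂ : e t ≤ ∑ v ∈ Y, e v := Finset.single_le_sum
      (fun v hv => h.excess_nonneg v fun hvs => hs (hvs ▸ hv)) ht
    linarith
  refine ⟨htX, hsX, fun Y ht hs => ?_, fun Y ht hs hle => ?_⟩
  · have := hY Y ht hs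
    have := Finset.sum_nonneg (hcross_nonneg Y)
    linarith
  · have h₁ := hY Y ht hs
    have h₂ := Finset.sum_nonneg (hcross_nonneg Y)
    have h₃ := (Finset.sum_eq_zero_iff_of_nonneg (hcross_nonneg Y)).1 (by linarith)
    -- Every vertex of `X` has a residual path to the sink, and no residual arc enters an equally
    -- cheap `Y`; hence `X ⊆ Y`.
    have reach : ∀ k u, d u = k → d u < Fintype.card V → u ∈ Y := by
      intro k
      induction k with
      | zero =>
        intro u hu hlt
        by_contra hne
        obtain ⟨v, _, hv⟩ := hrel u (by rintro rfl; exact hne ht) hlt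
        omega
      | succ k ih =>
        intro u hu hlt
        by_contra hne
        obtain ⟨v, hv, hv'⟩ := hrel u (by rintro rfl; exact hne ht) hlt
        have hvY := ih v (by omega) (by omega)
        have := (Finset.sum_eq_zero_iff_of_nonneg fun u _ => h.residual_nonneg u v).1 (h₃ v hvY) u
          (Finset.mem_compl.2 hne)
        linarith
    intro u hu
    exact reach _ u rfl (by simpa [hX] using hu)

end PushRelabel

/-! ## Odd-set constraints as cuts -/

namespace OneTwoOne

open OddCut

variable {N : ℕ}

/-- The connection activation times as a symmetric matrix with zero diagonal. -/
def Point.pairWeight (y : Point N) (u v : Fin (N + 2)) : ℝ :=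
  if u < v then y.lamHat u v else if v < u then y.lamHat v u else 0

/-- The total connection activation time at `v`. -/
noncomputable def Point.load (y : Point N) (v : Fin (N + 2)) : ℝ := ∑ u, y.pairWeight v u

/-- The weights on the nodes and one extra vertex, joined to every node by an edge that takes up the
slack of its degree constraint. -/
noncomputable def Point.weight (y : Point N) (u v : Fin (N + 2 + 1)) : ℝ :=
  Fin.lastCases (motive := fun _ => ℝ)
    (Fin.lastCases (motive := fun _ => ℝ) 0 (fun v' => 1 - y.load v') v)
    (fun u' => Fin.lastCases (motive := fun _ => ℝ) (1 - y.load u')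
      (fun v' => y.pairWeight u' v') v) u

theorem Point.pairWeight_comm (y : Point N) (u v : Fin (N + 2)) :
    y.pairWeight u v = y.pairWeight v u := by
  rcases lt_trichotomy u v with h | rfl | h
  · simp [pairWeight, h, h.not_gt]
  · rfl
  · simp [pairWeight, h, h.not_gt]

@[simp] theorem Point.pairWeight_self (y : Point N) (u : Fin (N + 2)) : y.pairWeight u u = 0 := by
  simp [pairWeight]

@[simp] theorem Point.weight_castSucc_castSucc (y : Point N) (u v : Fin (N + 2)) :
    y.weight u.castSucc v.castSucc = y.pairWeight u v := by simp [weight]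

@[simp] theorem Point.weight_castSucc_last (y : Point N) (u : Fin (N + 2)) :
    y.weight u.castSucc (Fin.last _) = 1 - y.load u := by simp [weight]

@[simp] theorem Point.weight_last_castSucc (y : Point N) (u : Fin (N + 2)) :
    y.weight (Fin.last _) u.castSucc = 1 - y.load u := by simp [weight]

@[simp] theorem Point.weight_last_last (y : Point N) :
    y.weight (Fin.last _) (Fin.last _) = 0 := by simp [weight]

theorem Point.weight_comm (y : Point N) (u v : Fin (N + 2 + 1)) : y.weight u v = y.weight v u := by
  induction u using Fin.lastCases <;> induction v using Fin.lastCases <;> simp [y.pairWeight_comm]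

theorem Point.weight_self (y : Point N) (u : Fin (N + 2 + 1)) : y.weight u u = 0 := by
  induction u using Fin.lastCases <;> simp

/-- Submodularity of the cut and the initial preflow need nonnegative weights; this is why the other
constraints are tested before the odd sets. -/
theorem Point.weight_nonneg {y : Point N} (h₀ : ∀ i j, i < j → 0 ≤ y.lamHat i j)
    (h₁ : ∀ v, y.load v ≤ 1) (u v : Fin (N + 2 + 1)) : 0 ≤ y.weight u v := by
  induction u using Fin.lastCases <;> induction v using Fin.lastCases
  · simp
  · simp [h₁]
  · simp [h₁]
  · rw [weight_castSucc_castSucc, pairWeight]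
    split_ifs with h h
    · exact h₀ _ _ h
    · exact h₀ _ _ h
    · rfl

theorem Point.sum_degree (y : Point N) (v : Fin (N + 2)) :
    ∑ e : Fin (N + 2) × Fin (N + 2) with e.1 < e.2 ∧ (e.1 = v ∨ e.2 = v), y.lamHat e.1 e.2 =
      y.load v := by
  rw [Finset.sum_filter, Fintype.sum_prod_type, load]
  have h : ∀ a b : Fin (N + 2), (if a < b ∧ (a = v ∨ b = v) then y.lamHat a b else 0) =
      (if a = v then (if v < b then y.lamHat v b else 0) else 0) +
      (if b = v then (if a < v then y.lamHat a v else 0) else 0) := by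
    intro a b
    by_cases ha : a = v
    · subst ha
      by_cases hb : b = a
      · simp [hb]
      · simp [hb]
    · by_cases hb : b = v
      · simp [ha, hb]
      · simp [ha, hb]
  simp only [h, Finset.sum_add_distrib, Finset.sum_ite_eq', Finset.mem_univ, if_true]
  rw [Finset.sum_comm]
  simp only [Finset.sum_ite_eq', Finset.mem_univ, if_true]
  rw [← Finset.sum_add_distrib]
  refine Finset.sum_congr rfl fun u _ => ?_
  rw [pairWeight]
  rcases lt_trichotomy u v with h | rfl | h
  · simp [h, h.not_gt]
  · simp
  · simp [h, h.not_gt]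

/-- Every edge inside `S` occurs in both orders. Doubling also removes the fraction from the
constraint, so the machine can test it without division. -/
theorem Point.sum_oddSet (y : Point N) (S : Finset (Fin (N + 2))) :
    2 * ∑ e : Fin (N + 2) × Fin (N + 2) with e.1 < e.2 ∧ e.1 ∈ S ∧ e.2 ∈ S, y.lamHat e.1 e.2 =
      ∑ u ∈ S, ∑ v ∈ S, y.pairWeight u v := by
  have h₁ : ∑ u ∈ S, ∑ v ∈ S, y.pairWeight u v =
      ∑ u ∈ S, ∑ v ∈ S, (if u < v then y.lamHat u v else 0) +
        ∑ u ∈ S, ∑ v ∈ S, (if v < u then y.lamHat v u else 0) := by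
    simp only [← Finset.sum_add_distrib]
    refine Finset.sum_congr rfl fun u _ => Finset.sum_congr rfl fun v _ => ?_
    rw [pairWeight]
    rcases lt_trichotomy u v with h | rfl | h
    · simp [h, h.not_gt]
    · simp
    · simp [h, h.not_gt]
  have h₂ : ∑ e : Fin (N + 2) × Fin (N + 2) with e.1 < e.2 ∧ e.1 ∈ S ∧ e.2 ∈ S,
      y.lamHat e.1 e.2 = ∑ u ∈ S, ∑ v ∈ S, (if u < v then y.lamHat u v else 0) := by
    rw [← Finset.sum_product', ← Finset.sum_filter]
    refine Finset.sum_congr ?_ fun _ _ => rfl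
    ext e
    simp [and_comm]
  rw [h₁, ← h₂, Finset.sum_comm (s := S) (t := S) (f := fun u v => if v < u then _ else _), ← h₂,
    two_mul]

theorem Constraint.sat_degree_iff {ell : Network N} {y : Point N} (v : Fin (N + 2)) :
    (Constraint.degree v).Sat ell y ↔ y.load v ≤ 1 := by
  rw [← y.sum_degree, Sat]

theorem Constraint.sat_oddSet_iff {ell : Network N} {y : Point N} (S : Finset (Fin (N + 2)))
    (h : Odd S.card) : (Constraint.oddSet S h).Sat ell y ↔
      1 - (S.card : ℝ) + ∑ u ∈ S, ∑ v ∈ S, y.pairWeight u v ≤ 0 := by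
  rw [← y.sum_oddSet, Sat]
  constructor <;> intro h <;> linarith

/-- A set of nodes as a set of vertices of the extended graph. -/
def lift (S : Finset (Fin (N + 2))) : Finset (Fin (N + 2 + 1)) := S.map Fin.castSuccEmb

theorem last_notMem_lift (S : Finset (Fin (N + 2))) : Fin.last _ ∉ lift S := by
  simp [lift]

theorem castSucc_mem_lift {S : Finset (Fin (N + 2))} {v : Fin (N + 2)} :
    v.castSucc ∈ lift S ↔ v ∈ S := by
  simp [lift]

theorem Point.cut_lift (y : Point N) (S : Finset (Fin (N + 2))) :
    cut y.weight (lift S) = S.card - ∑ u ∈ S, ∑ v ∈ S, y.pairWeight u v := by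
  rw [cut, lift, Finset.sum_map]
  have h : ∀ u ∈ S, ∑ v ∈ (S.map Fin.castSuccEmb)ᶜ, y.weight (Fin.castSuccEmb u) v =
      1 - ∑ v ∈ S, y.pairWeight u v := by
    intro u _
    -- The edge to the extra vertex fills the load of `u` up to 1.
    have h₁ : ∑ v, y.weight (Fin.castSuccEmb u) v = 1 := by
      simp [Fin.sum_univ_castSucc, load]
    have h₂ := Finset.sum_add_sum_compl (S.map Fin.castSuccEmb) (y.weight (Fin.castSuccEmb u))
    rw [h₁, Finset.sum_map] at h₂
    simp only [Fin.coe_castSuccEmb, weight_castSucc_castSucc] at h₂ ⊢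
    linarith
  rw [Finset.sum_congr rfl h, Finset.sum_sub_distrib]
  simp

/-- A weight whose parity on `lift S` is that of the cardinality of `S`. -/
def parityWeight (v : Fin (N + 2 + 1)) : ℕ :=
  Fin.lastCases (motive := fun _ => ℕ) (N + 2) (fun _ => 1) v

theorem sum_parityWeight_lift (S : Finset (Fin (N + 2))) :
    ∑ v ∈ lift S, parityWeight v = S.card := by
  simp [lift, parityWeight]

theorem even_sum_parityWeight : Even (∑ v : Fin (N + 2 + 1), parityWeight v) :=
  ⟨N + 2, by simp [parityWeight, Fin.sum_univ_castSucc]⟩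

/-- The odd-set constraints hold if they hold for the minimal minimum cuts. -/
theorem sat_oddSet_of_minCuts {ell : Network N} {y : Point N} (hw : ∀ u v, 0 ≤ y.weight u v)
    (h : ∀ a b, a ≠ b → ∃ X S, IsMinCut (cut y.weight) a b X ∧ (lift S = X ∨ lift S = Xᶜ) ∧
      ∀ hS : Odd S.card, (Constraint.oddSet S hS).Sat ell y)
    (S : Finset (Fin (N + 2))) (hS : Odd S.card) : (Constraint.oddSet S hS).Sat ell y := by
  choose! X R hX hR hsat using h
  have symm : ∀ A, cut y.weight Aᶜ = cut y.weight A := cut_compl y.weight_comm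
  obtain ⟨a, b, hab, hodd, hle⟩ := exists_odd_isMinCut symm (cut_submodular hw)
    even_sum_parityWeight hX (S := lift S) (by rwa [sum_parityWeight_lift])
  have hcut : cut y.weight (lift (R a b)) = cut y.weight (X a b) := by
    rcases hR a b hab with h | h
    · rw [h]
    · rw [h, symm]
  -- If `R a b` lifts to the complement of the cut, the parity carries over because the total weight
  -- is even.
  have hodd' : Odd (R a b).card := by
    rw [← sum_parityWeight_lift]
    rcases hR a b hab with h | h
    · rwa [h]
    · rw [h]
      have := even_sum_parityWeight (N := N)
      rw [← Finset.sum_add_sum_compl (X a b), Nat.even_add'] at this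
      exact this.1 hodd
  have := (Constraint.sat_oddSet_iff _ hodd').1 (hsat a b hab hodd')
  rw [← hcut, y.cut_lift, y.cut_lift] at hle
  rw [Constraint.sat_oddSet_iff]
  linarith

end OneTwoOne

/-! ## Scanning the constraints that are indexed by nodes -/

namespace OneTwoOne

open RealRAM

section programs

/-- `e = f` -/
abbrev natEq (e f : NExp) : BExp := .and (.natLe e f) (.natLe f e)

/-- Unless an answer has been found, answer with constraint kind `k` at variables `5` and `6`
if `b` holds. -/
def report (k : ℕ) (b : BExp) : Prog :=
  .cond (.and (.natLe (.var 0) (.lit 0)) b)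
    (.seq (.setVar 1 (.var 5)) (.seq (.setVar 2 (.var 6)) (.setVar 0 (.lit k)))) .nop

/-- Report a pair of nodes with the property `b` as a violation of kind `k`. -/
def scan (k : ℕ) (b : BExp) : Prog := .forLoop 5 3 (.forLoop 6 3 (report k b))

/-- For every node `i`, store in row `i` of the real array `a` the sum of `e` over the nodes with
property `g`. -/
def rowSums (a : ℕ) (e : RExp) (g : BExp) : Prog :=
  .forLoop 5 3 (.seq (.setReal a (.var 5) (.lit 0) .zero)
    (.forLoop 6 3
      (.cond g (.setReal a (.var 5) (.lit 0) (.add (.get a (.var 5) (.lit 0)) e)) .nop)))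

/-- Run `c` for all pairs of values below variable `b` of the variables `5` and `6`. -/
def pairLoop (b : ℕ) (c : Prog) : Prog := .forLoop 5 b (.forLoop 6 b c)

end programs

/-! ### Correctness of the scanning programs -/

section status

variable {N : ℕ} {ell : Network N} {y : Point N} {m : ℕ} {I : Input} {s : State}

theorem natBeq_eq_false {a b : ℕ} (h : a ≠ b) : Nat.beq a b = false :=
  Bool.eq_false_iff.2 fun h' => h (Nat.eq_of_beq_eq_true h')

theorem Answer.var_ne_zero {c : Constraint N} (h : Answer s (some c)) : s.var 0 ≠ 0 := by
  cases c <;> simp_all [Answer]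

theorem Answer.congr {s' : State} {c : Constraint N} (h₀ : s'.var 0 = s.var 0)
    (h₁ : s'.var 1 = s.var 1) (h₂ : s'.var 2 = s.var 2) (hn : s'.nat 0 = s.nat 0)
    (h : Answer s (some c)) : Answer s' (some c) := by
  cases c <;> simp_all [Answer]

/-- Either a violated constraint has been found, or none has been found and `P` holds. -/
def Status (ell : Network N) (y : Point N) (P : Prop) (s : State) : Prop :=
  (∃ c : Constraint N, Answer s (some c) ∧ ¬ c.Sat ell y) ∨ (s.var 0 = 0 ∧ P)

theorem Status.imp {P P' : Prop} (h : Status ell y P s) (hP : P → P') : Status ell y P' s :=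
  h.imp_right fun h => ⟨h.1, hP h.2⟩

theorem Status.congr {s' : State} {P : Prop} (h : Status ell y P s) (h₀ : s'.var 0 = s.var 0)
    (h₁ : s'.var 1 = s.var 1) (h₂ : s'.var 2 = s.var 2) (hn : s'.nat 0 = s.nat 0) :
    Status ell y P s' := by
  rcases h with ⟨c, hc, hc'⟩ | ⟨h, hP⟩
  · exact Or.inl ⟨c, hc.congr h₀ h₁ h₂ hn, hc'⟩
  · exact Or.inr ⟨h₀.trans h, hP⟩

/-- An answer is read only from variables `0`, `1`, `2` and array `0` of natural numbers. -/
theorem Status.frame {c : Prog} {s' : State} {P : Prop} (h : Status ell y P s)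
    (hF : Frame c s s') (h₀ : c.keepsVar 0 = true) (h₁ : c.keepsVar 1 = true)
    (h₂ : c.keepsVar 2 = true) (hn : c.keepsNat 0 = true) : Status ell y P s' :=
  h.congr (hF.var 0 h₀) (hF.var 1 h₁) (hF.var 2 h₂) (hF.nat 0 hn)

theorem Status.putVar {x v : ℕ} {P : Prop} (h : Status ell y P s) (hx : 2 < x) :
    Status ell y P (s.putVar x v) := by
  refine h.congr ?_ ?_ ?_ rfl <;> simp <;> omega

theorem wp_report {P P' : Prop} {k : ℕ} {b : BExp} {Q : State → Prop} (hst : Status ell y P s)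
    (hans : P → b.Holds I s → ∃ c : Constraint N, ¬ c.Sat ell y ∧ ∀ s' : State, s'.var 0 = k →
      s'.var 1 = s.var 5 → s'.var 2 = s.var 6 → Answer s' (some c))
    (hP : P → ¬ b.Holds I s → P') (done : ∀ s', Status ell y P' s' → Q s') :
    WP m I (report k b) s Q := by
  refine wp_cond (fun h => wp_seq (wp_setVar (wp_seq (wp_setVar (wp_setVar (done _ ?_))))))
    fun h => wp_nop (done _ ?_)
  · obtain ⟨h, hb⟩ := h
    rcases hst with ⟨c, hc, _⟩ | ⟨_, hp⟩
    · exact absurd (Nat.le_zero.1 h) hc.var_ne_zero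
    · obtain ⟨c, hc, hc'⟩ := hans hp hb
      exact Or.inl ⟨c, hc' _ (by simp [NExp.eval]) (by simp [NExp.eval]) (by simp [NExp.eval]), hc⟩
  · rcases hst with hst | ⟨h₀, hp⟩
    · exact Or.inl hst
    · exact Or.inr ⟨h₀, hP hp fun hb => h ⟨h₀.le, hb⟩⟩

/-- The loops run to the end even after a success; `report` is then idle, so the first violation
found stands. -/
theorem wp_scan {P : Prop} {k : ℕ} {b : BExp} {Q : State → Prop} (bad : ℕ → ℕ → Prop)
    (h3 : s.var 3 = N + 2) (hm : N + 2 ≤ m) (hst : Status ell y P s)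
    (hbad : ∀ (s' : State) (i j : ℕ), s'.var 3 = N + 2 → i < N + 2 → j < N + 2 → s'.var 5 = i → s'.var 6 = j →
      s'.real = s.real → (b.Holds I s' ↔ bad i j))
    (hans : P → ∀ i j, i < N + 2 → j < N + 2 → bad i j → ∃ c : Constraint N, ¬ c.Sat ell y ∧
      ∀ s' : State, s'.var 0 = k → s'.var 1 = i → s'.var 2 = j → Answer s' (some c))
    (done : ∀ s', Frame (scan k b) s s' →
      Status ell y (P ∧ ∀ i < N + 2, ∀ j < N + 2, ¬ bad i j) s' → Q s') :
    WP m I (scan k b) s Q := by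
  refine wp_forLoop (fun i => Status ell y (P ∧ ∀ i' < i, ∀ j < N + 2, ¬ bad i' j)) h3 hm rfl rfl
    ((hst.putVar (by simp)).imp fun h => ⟨h, by simp⟩) ?_ done
  intro i s₁ hi h5 hF hJ
  have h3₁ := hF.var 3 rfl
  refine wp_forLoop (fun j => Status ell y ((P ∧ ∀ i' < i, ∀ j < N + 2, ¬ bad i' j) ∧
    ∀ j' < j, ¬ bad i j')) (h3₁.trans h3) hm rfl rfl
    ((hJ.putVar (by simp)).imp fun h => ⟨h, by simp⟩) ?_ ?_
  · intro j s₂ hj h6 hF₂ hJ₂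
    have h5₂ := (hF₂.var 5 rfl).trans h5
    have hb := hbad s₂ i j ((hF₂.var 3 rfl).trans (h3₁.trans h3)) hi hj h5₂ h6 (by
      funext a
      exact (hF₂.real a rfl).trans (hF.real a rfl))
    refine wp_report (P' := ((P ∧ ∀ i' < i, ∀ j < N + 2, ¬ bad i' j) ∧
      ∀ j' < j + 1, ¬ bad i j')) hJ₂ ?_ ?_ fun s' hs' => hs'.putVar (by simp)
    · rw [hb, h5₂, h6]
      exact fun hp hb => hans hp.1.1 i j hi hj hb
    · rw [hb]
      intro hp hb
      refine ⟨hp.1, fun j' hj' => ?_⟩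
      rcases Nat.lt_succ_iff_lt_or_eq.1 hj' with h | rfl
      · exact hp.2 j' h
      · exact hb
  · intro s₂ _ hJ₂
    refine (hJ₂.putVar (by simp)).imp fun hp => ⟨hp.1.1, fun i' hi' => ?_⟩
    rcases Nat.lt_succ_iff_lt_or_eq.1 hi' with h | rfl
    · exact hp.1.2 i' h
    · exact hp.2

/-- The summand may read every real array except the one being written, whence the hypothesis on `b
≠ a` in `hE`. -/
theorem wp_rowSums {n a : ℕ} {e : RExp} {g : BExp} {Q : State → Prop} {G : ℕ → ℕ → Prop}
    [∀ i j, Decidable (G i j)] {E : ℕ → ℕ → ℝ} (h3 : s.var 3 = n) (hm : n ≤ m)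
    (hG : ∀ (s' : State) (i j : ℕ), s'.var 3 = n → s'.var 5 = i → s'.var 6 = j →
      (g.Holds I s' ↔ G i j))
    (hE : ∀ (s' : State) (i j : ℕ), s'.var 5 = i → s'.var 6 = j →
      (∀ b, b ≠ a → s'.real b = s.real b) → e.eval I s' = E i j)
    (done : ∀ s', Frame (rowSums a e g) s s' →
      (∀ i < n, s'.real a i 0 = ∑ j ∈ Finset.range n, if G i j then E i j else 0) → Q s') :
    WP m I (rowSums a e g) s Q := by
  have keep : ∀ b, b ≠ a → (rowSums a e g).keepsReal b = true := by
    intro b hb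
    simp [rowSums, Prog.forLoop, Prog.keepsReal, natBeq_eq_false hb.symm]
  refine wp_forLoop (fun i s' => ∀ i' < i,
    s'.real a i' 0 = ∑ j ∈ Finset.range n, if G i' j then E i' j else 0) h3 hm rfl rfl
    (by simp) ?_ done
  intro i s₁ hi h5 hF hJ
  have h3₁ := (hF.var 3 rfl).trans h3
  refine wp_seq (wp_setReal ?_)
  simp only [NExp.eval, RExp.eval, h5]
  refine wp_forLoop (fun k s' => (∀ i' < i, s'.real a i' 0 = s₁.real a i' 0) ∧
    s'.real a i 0 = ∑ j ∈ Finset.range k, if G i j then E i j else 0) h3₁ hm rfl rfl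
    ?_ ?_ ?_
  · refine ⟨fun i' hi' => ?_, by simp⟩
    simp [hi'.ne]
  · intro j s₂ hj h6 hF₂ hJ₂
    have h5₂ : s₂.var 5 = i := (hF₂.var 5 rfl).trans h5
    have hr : ∀ b, b ≠ a → s₂.real b = s.real b := by
      intro b hb
      have h₁ := hF₂.real b (by simpa [rowSums, Prog.forLoop, Prog.keepsReal] using keep b hb)
      rw [h₁, ← hF.real b (keep b hb)]
      funext k l
      simp [hb]
    have he := hE s₂ i j h5₂ h6 hr
    have hg := hG s₂ i j ((hF₂.var 3 rfl).trans h3₁) h5₂ h6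
    refine wp_cond (fun h => wp_setReal ?_) fun h => wp_nop ?_
    · simp only [NExp.eval, RExp.eval, h5₂, he]
      refine ⟨fun i' hi' => ?_, ?_⟩
      · simpa [hi'.ne] using hJ₂.1 i' hi'
      · simp [Finset.sum_range_succ, hJ₂.2, hg.1 h]
    · refine ⟨hJ₂.1, ?_⟩
      simpa [Finset.sum_range_succ, hg.not.1 h] using hJ₂.2
  · intro s₂ _ hJ₂ i' hi'
    rcases Nat.lt_succ_iff_lt_or_eq.1 hi' with h | rfl
    · exact (hJ₂.1 i' h).trans (hJ i' h)
    · exact hJ₂.2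

/-- A pair loop whose body fills in one entry of the real array `a`. -/
theorem wp_pairLoop_fill {b n a : ℕ} {c : Prog} {Q : State → Prop} {E : ℕ → ℕ → ℝ}
    (hb : s.var b = n) (hm : n ≤ m) (hv : ∀ x, c.keepsVar x = true) (hb5 : b ≠ 5) (hb6 : b ≠ 6)
    (hr : ∀ a', a' ≠ a → c.keepsReal a' = true)
    (hc : ∀ (s' : State) (i j : ℕ) (Q' : State → Prop), s'.var 5 = i → s'.var 6 = j →
      (∀ x, x ≠ 5 → x ≠ 6 → s'.var x = s.var x) → (∀ a', a' ≠ a → s'.real a' = s.real a') →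
      Q' (s'.putReal a i j (E i j)) → WP m I c s' Q')
    (done : ∀ s', Frame (pairLoop b c) s s' →
      (∀ i < n, ∀ j < n, s'.real a i j = E i j) → Q s') :
    WP m I (pairLoop b c) s Q := by
  have kv : ∀ x, x ≠ 5 → x ≠ 6 → (pairLoop b c).keepsVar x = true := by
    intro x h5 h6
    simp [pairLoop, Prog.forLoop, Prog.keepsVar, natBeq_eq_false h5.symm,
      natBeq_eq_false h6.symm, hv]
  have kv' : ∀ x, x ≠ 6 → (Prog.forLoop 6 b c).keepsVar x = true := by
    intro x h6
    simp [Prog.forLoop, Prog.keepsVar, natBeq_eq_false h6.symm, hv]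
  refine wp_forLoop (fun i s' => ∀ i' < i, ∀ j < n, s'.real a i' j = E i' j) hb hm (kv b hb5 hb6)
    (kv' 5 (by simp)) (by simp) ?_ done
  intro i s₁ hi h5 hF hJ
  refine wp_forLoop (fun k s' => (∀ i' < i, ∀ j < n, s'.real a i' j = E i' j) ∧
    ∀ j < k, s'.real a i j = E i j) ((hF.var b (kv b hb5 hb6)).trans hb) hm (kv' b hb6) (hv 6)
    ⟨hJ, by simp⟩ ?_ ?_
  · intro j s₂ hj h6 hF₂ hJ₂
    refine hc s₂ i j _ ((hF₂.var 5 (kv' 5 (by simp))).trans h5) h6 ?_ ?_ ?_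
    · exact fun x h5 h6 => (hF₂.var x (kv' x h6)).trans (hF.var x (kv x h5 h6))
    · intro a' ha'
      refine (hF₂.real a' ?_).trans (hF.real a' ?_)
      · simp [Prog.forLoop, Prog.keepsReal, hr a' ha']
      · simp [Prog.forLoop, Prog.keepsReal, hr a' ha']
    · refine ⟨fun i' hi' j' hj' => ?_, fun j' hj' => ?_⟩
      · simpa [hi'.ne] using hJ₂.1 i' hi' j' hj'
      · rcases Nat.lt_succ_iff_lt_or_eq.1 hj' with h | rfl
        · simpa [h.ne] using hJ₂.2 j' h
        · simp
  · intro s₂ _ hJ₂ i' hi'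
    rcases Nat.lt_succ_iff_lt_or_eq.1 hi' with h | rfl
    · exact hJ₂.1 i' h
    · exact hJ₂.2

end status

end OneTwoOne

/-! ### Link, conservation and degree constraints -/

namespace OneTwoOne

open RealRAM

section programs

/-- Store the numbers `N + 2` and `N + 3` and clear the answer. -/
def prepare : Prog :=
  .seq (.setVar 3 (.add (.var 0) (.lit 2))) (.seq (.setVar 4 (.add (.var 0) (.lit 3)))
    (.setVar 0 (.lit 0)))

/-- Variables `5` and `6` are the ends of a possible link. -/
def isLink : BExp := .and (.natLt (.add (.var 5) (.lit 1)) (.var 3)) (.natLe (.lit 1) (.var 6))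

/-- Variable `5` is a relay. -/
def isRelay : BExp := .and (.natLt (.add (.var 5) (.lit 1)) (.var 3)) (.natLe (.lit 1) (.var 5))

/-- The sum of the two activation times of the links between variables `5` and `6`. -/
def lamSum : RExp := .add (.inp 2 (.var 5) (.var 6)) (.inp 2 (.var 6) (.var 5))

/-- Check the constraints on single links and connections. -/
def checkLinks : Prog :=
  .seq (scan 1 (.and isLink (.realLt (.inp 1 (.var 6) (.var 5)) .zero)))
  (.seq (scan 2 (.and isLink (.realLt (.inpMul 2 (.var 6) (.var 5) 0 (.var 6) (.var 5))
    (.inp 1 (.var 6) (.var 5)))))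
  (.seq (scan 7 (.and isLink (.realLt (.inp 2 (.var 5) (.var 6)) .zero)))
  (.seq (scan 5 (.and (.natLt (.var 5) (.var 6)) (.realLt lamSum (.inp 3 (.var 5) (.var 6)))))
  (.seq (scan 6 (.and (.natLt (.var 5) (.var 6)) (.realLt (.inp 3 (.var 5) (.var 6)) lamSum)))
  (scan 10 (.and (.natLt (.var 5) (.var 6)) (.realLt (.inp 3 (.var 5) (.var 6)) .zero)))))))

/-- Check the conservation of flow at the relays. -/
def checkConservation : Prog :=
  .seq (rowSums 4 (.inp 1 (.var 6) (.var 5))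
    (.and (.natLe (.lit 1) (.var 6)) (.neg (natEq (.var 6) (.var 5)))))
  (.seq (rowSums 5 (.inp 1 (.var 5) (.var 6))
    (.and (.natLt (.add (.var 6) (.lit 1)) (.var 3)) (.neg (natEq (.var 6) (.var 5)))))
  (.seq (scan 3 (.and isRelay (.realLt (.get 5 (.var 5) (.lit 0)) (.get 4 (.var 5) (.lit 0)))))
  (scan 4 (.and isRelay (.realLt (.get 4 (.var 5) (.lit 0)) (.get 5 (.var 5) (.lit 0)))))))

/-- Enter the connection activation time of variables `5` and `6` into array `1`. -/
def fillPairWeight : Prog :=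
  .cond (.natLt (.var 5) (.var 6)) (.setReal 1 (.var 5) (.var 6) (.inp 3 (.var 5) (.var 6)))
    (.cond (.natLt (.var 6) (.var 5)) (.setReal 1 (.var 5) (.var 6) (.inp 3 (.var 6) (.var 5)))
      (.setReal 1 (.var 5) (.var 6) .zero))

/-- Enter the slack of the degree constraint at variable `5` into array `1`. -/
def fillSlack : Prog :=
  .seq (.setReal 1 (.var 5) (.var 3) (.sub .one (.get 6 (.var 5) (.lit 0))))
    (.setReal 1 (.var 3) (.var 5) (.sub .one (.get 6 (.var 5) (.lit 0))))

/-- Check the degree constraints and enter the weights of the extended graph into array `1`. -/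
def checkDegrees : Prog :=
  .seq (pairLoop 3 fillPairWeight)
  (.seq (rowSums 6 (.get 1 (.var 5) (.var 6)) (.natLe (.lit 0) (.lit 0)))
  (.seq (scan 8 (.realLt .one (.get 6 (.var 5) (.lit 0))))
  (.seq (.forLoop 5 3 fillSlack) (.setReal 1 (.var 3) (.var 3) .zero))))

end programs

section specifications

variable {N : ℕ} {ell : Network N} {y : Point N} {m : ℕ} {s : State} {Q : State → Prop}

theorem input_ell (i j : Fin (N + 2)) : input ell y 0 i j = ell i j := by simp [input]
theorem input_F (i j : Fin (N + 2)) : input ell y 1 i j = y.F i j := by simp [input]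
theorem input_lam (i j : Fin (N + 2)) : input ell y 2 i j = y.lam i j := by simp [input]
theorem input_lamHat (i j : Fin (N + 2)) : input ell y 3 i j = y.lamHat i j := by simp [input]

/-- The constraints on single links and connections hold. -/
structure LinksSat (ell : Network N) (y : Point N) : Prop where
  flowNonneg : ∀ i j, (Constraint.flowNonneg i j).Sat ell y
  flowLe : ∀ i j, (Constraint.flowLe i j).Sat ell y
  lamNonneg : ∀ i j, (Constraint.lamNonneg i j).Sat ell y
  sumLe : ∀ i j h, (Constraint.sumLe i j h).Sat ell y
  sumGe : ∀ i j h, (Constraint.sumGe i j h).Sat ell y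
  lamHatNonneg : ∀ i j h, (Constraint.lamHatNonneg i j h).Sat ell y

/-- A scan for violations of the constraints of a family; `R x i j` says that `x` is represented
by the values `i` and `j` of the variables `5` and `6`. -/
theorem wp_scan_family {P : Prop} {k : ℕ} {b : BExp} {ι : Type*} (c : ι → Constraint N)
    (R : ι → ℕ → ℕ → Prop) (h3 : s.var 3 = N + 2) (hm : N + 2 ≤ m) (hst : Status ell y P s)
    (hR : ∀ x, ∃ i < N + 2, ∃ j < N + 2, R x i j)
    (hcover : ∀ s' : State, s'.var 3 = N + 2 → s'.var 5 < N + 2 → s'.var 6 < N + 2 →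
      b.Holds (input ell y) s' → ∃ x, R x (s'.var 5) (s'.var 6))
    (hsat : ∀ (s' : State) x, s'.var 3 = N + 2 → s'.real = s.real → R x (s'.var 5) (s'.var 6) →
      (b.Holds (input ell y) s' ↔ ¬ (c x).Sat ell y))
    (hans : ∀ (s' : State) x, s'.var 0 = k → R x (s'.var 1) (s'.var 2) →
      Answer s' (some (c x)))
    (done : ∀ s', Frame (scan k b) s s' → Status ell y (P ∧ ∀ x, (c x).Sat ell y) s' → Q s') :
    WP m (input ell y) (scan k b) s Q := by
  refine wp_scan (fun i j => ∃ x, R x i j ∧ ¬ (c x).Sat ell y) h3 hm hst ?_ ?_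
    fun s' hF h => done s' hF (h.imp fun h => ⟨h.1, ?_⟩)
  · rintro s' _ _ h3' hi hj rfl rfl hr
    refine ⟨fun hb => ?_, fun ⟨x, hx, hx'⟩ => (hsat s' x h3' hr hx).2 hx'⟩
    obtain ⟨x, hx⟩ := hcover s' h3' hi hj hb
    exact ⟨x, hx, (hsat s' x h3' hr hx).1 hb⟩
  · rintro _ i j _ _ ⟨x, hx, hx'⟩
    exact ⟨c x, hx', fun s' h₀ h₁ h₂ => hans s' x h₀ (by rwa [h₁, h₂])⟩
  · intro x
    obtain ⟨i, hi, j, hj, hx⟩ := hR x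
    by_contra hc
    exact h.2 i hi j hj ⟨x, hx, hc⟩

theorem wp_scan_link {P : Prop} {k : ℕ} {b : BExp} (c : Fin (N + 1) × Fin (N + 1) → Constraint N)
    (h3 : s.var 3 = N + 2) (hm : N + 2 ≤ m) (hst : Status ell y P s)
    (hsat : ∀ (s' : State) x, s'.var 5 = x.1.castSucc.val → s'.var 6 = x.2.succ.val →
      (b.Holds (input ell y) s' ↔ ¬ (c x).Sat ell y))
    (hans : ∀ (s' : State) x, s'.var 0 = k → s'.var 1 = x.1.castSucc.val →
      s'.var 2 = x.2.succ.val → Answer s' (some (c x)))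
    (done : ∀ s', Frame (scan k (.and isLink b)) s s' →
      Status ell y (P ∧ ∀ x, (c x).Sat ell y) s' → Q s') :
    WP m (input ell y) (scan k (.and isLink b)) s Q := by
  refine wp_scan_family c (fun x i j => i = x.1.castSucc.val ∧ j = x.2.succ.val) h3 hm hst
    (fun x => ⟨_, x.1.castSucc.isLt, _, x.2.succ.isLt, rfl, rfl⟩) ?_ ?_
    (fun s' x h₀ h => hans s' x h₀ h.1 h.2) done
  · rintro s' h3' h5 h6 ⟨⟨h₁, h₂⟩, _⟩
    simp only [BExp.Holds, NExp.eval, h3'] at h₁ h₂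
    -- The second node is a successor, so its index in `Fin (N + 1)` is one less.
    exact ⟨(⟨s'.var 5, by omega⟩, ⟨s'.var 6 - 1, by omega⟩), rfl, by simp; omega⟩
  · rintro s' x h3' _ ⟨h5, h6⟩
    rw [← hsat s' x h5 h6, BExp.Holds, and_iff_right]
    simp only [isLink, BExp.Holds, NExp.eval, h3', h5, h6, Fin.val_castSucc, Fin.val_succ]
    omega

theorem wp_scan_pair {P : Prop} {k : ℕ} {b : BExp}
    (c : {x : Fin (N + 2) × Fin (N + 2) // x.1 < x.2} → Constraint N)
    (h3 : s.var 3 = N + 2) (hm : N + 2 ≤ m) (hst : Status ell y P s)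
    (hsat : ∀ (s' : State) x, s'.var 5 = x.1.1.val → s'.var 6 = x.1.2.val →
      (b.Holds (input ell y) s' ↔ ¬ (c x).Sat ell y))
    (hans : ∀ (s' : State) x, s'.var 0 = k → s'.var 1 = x.1.1.val →
      s'.var 2 = x.1.2.val → Answer s' (some (c x)))
    (done : ∀ s', Frame (scan k (.and (.natLt (.var 5) (.var 6)) b)) s s' →
      Status ell y (P ∧ ∀ x, (c x).Sat ell y) s' → Q s') :
    WP m (input ell y) (scan k (.and (.natLt (.var 5) (.var 6)) b)) s Q := by
  refine wp_scan_family c (fun x i j => i = x.1.1.val ∧ j = x.1.2.val) h3 hm hst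
    (fun x => ⟨_, x.1.1.isLt, _, x.1.2.isLt, rfl, rfl⟩) ?_ ?_
    (fun s' x h₀ h => hans s' x h₀ h.1 h.2) done
  · rintro s' h3' h5 h6 ⟨h, _⟩
    exact ⟨⟨(⟨s'.var 5, h5⟩, ⟨s'.var 6, h6⟩), h⟩, rfl, rfl⟩
  · rintro s' ⟨x, hx⟩ h3' _ ⟨h5, h6⟩
    rw [← hsat s' ⟨x, hx⟩ h5 h6, BExp.Holds, and_iff_right]
    simp only [BExp.Holds, NExp.eval, h5, h6]
    exact hx

theorem wp_checkLinks {P : Prop} (h3 : s.var 3 = N + 2) (hm : N + 2 ≤ m)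
    (hst : Status ell y P s)
    (done : ∀ s', Frame checkLinks s s' → Status ell y (P ∧ LinksSat ell y) s' → Q s') :
    WP m (input ell y) checkLinks s Q := by
  -- `WP.imp` supplies the frame of the whole program, which then need not be assembled from its
  -- parts.
  suffices h : WP m (input ell y) checkLinks s (Status ell y (P ∧ LinksSat ell y)) from
    h.imp fun s' hF h => done s' hF h
  refine wp_seq (wp_scan_link (fun x => .flowNonneg x.1 x.2) h3 hm hst ?_
    (fun _ _ h₀ h₁ h₂ => ⟨h₀, h₁, h₂⟩) fun s₁ hF₁ h₁ => ?_)
  · intro s' x h5 h6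
    simp only [BExp.Holds, RExp.eval, NExp.eval, h5, h6, input_F, Constraint.Sat]
  have h3₁ := (hF₁.var 3 rfl).trans h3
  refine wp_seq (wp_scan_link (fun x => .flowLe x.1 x.2) h3₁ hm h₁ ?_
    (fun _ _ h₀ h₁ h₂ => ⟨h₀, h₁, h₂⟩) fun s₂ hF₂ h₂ => ?_)
  · intro s' x h5 h6
    simp only [BExp.Holds, RExp.eval, NExp.eval, h5, h6, input_F, input_lam, input_ell,
      Constraint.Sat]
  have h3₂ := (hF₂.var 3 rfl).trans h3₁
  refine wp_seq (wp_scan_link (fun x => .lamNonneg x.1 x.2) h3₂ hm h₂ ?_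
    (fun _ _ h₀ h₁ h₂ => ⟨h₀, h₁, h₂⟩) fun s₃ hF₃ h₃ => ?_)
  · intro s' x h5 h6
    simp only [BExp.Holds, RExp.eval, NExp.eval, h5, h6, input_lam, Constraint.Sat]
  have h3₃ := (hF₃.var 3 rfl).trans h3₂
  refine wp_seq (wp_scan_pair (fun x => .sumLe x.1.1 x.1.2 x.2) h3₃ hm h₃ ?_
    (fun _ _ h₀ h₁ h₂ => ⟨h₀, h₁, h₂⟩) fun s₄ hF₄ h₄ => ?_)
  · intro s' x h5 h6
    simp only [BExp.Holds, lamSum, RExp.eval, NExp.eval, h5, h6, input_lam, input_lamHat,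
      Constraint.Sat]
  have h3₄ := (hF₄.var 3 rfl).trans h3₃
  refine wp_seq (wp_scan_pair (fun x => .sumGe x.1.1 x.1.2 x.2) h3₄ hm h₄ ?_
    (fun _ _ h₀ h₁ h₂ => ⟨h₀, h₁, h₂⟩) fun s₅ hF₅ h₅ => ?_)
  · intro s' x h5 h6
    simp only [BExp.Holds, lamSum, RExp.eval, NExp.eval, h5, h6, input_lam, input_lamHat,
      Constraint.Sat]
  have h3₅ := (hF₅.var 3 rfl).trans h3₄
  refine wp_scan_pair (fun x => .lamHatNonneg x.1.1 x.1.2 x.2) h3₅ hm h₅ ?_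
    (fun _ _ h₀ h₁ h₂ => ⟨h₀, h₁, h₂⟩) fun s₆ _ h₆ => ?_
  · intro s' x h5 h6
    simp only [BExp.Holds, RExp.eval, NExp.eval, h5, h6, input_lamHat, Constraint.Sat]
  exact h₆.imp fun ⟨⟨⟨⟨⟨⟨hP, k₁⟩, k₂⟩, k₃⟩, k₄⟩, k₅⟩, k₆⟩ => ⟨hP, fun i j => k₁ (i, j),
    fun i j => k₂ (i, j), fun i j => k₃ (i, j), fun i j h => k₄ ⟨(i, j), h⟩,
    fun i j h => k₅ ⟨(i, j), h⟩, fun i j h => k₆ ⟨(i, j), h⟩⟩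

theorem wp_scan_relay {P : Prop} {k : ℕ} {b : BExp} (c : Fin N → Constraint N)
    (h3 : s.var 3 = N + 2) (hm : N + 2 ≤ m) (hst : Status ell y P s)
    (hsat : ∀ (s' : State) x, s'.real = s.real → s'.var 5 = x.succ.castSucc.val →
      (b.Holds (input ell y) s' ↔ ¬ (c x).Sat ell y))
    (hans : ∀ (s' : State) x, s'.var 0 = k → s'.var 1 = x.succ.castSucc.val →
      Answer s' (some (c x)))
    (done : ∀ s', Frame (scan k (.and isRelay b)) s s' →
      Status ell y (P ∧ ∀ x, (c x).Sat ell y) s' → Q s') :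
    WP m (input ell y) (scan k (.and isRelay b)) s Q := by
  -- One node indexes the constraint; the inner counter is idle, and 0 is a value it takes.
  refine wp_scan_family c (fun x i _ => i = x.succ.castSucc.val) h3 hm hst
    (fun x => ⟨_, x.succ.castSucc.isLt, 0, by simp, rfl⟩) ?_ ?_ hans done
  · rintro s' h3' h5 h6 ⟨⟨h₁, h₂⟩, _⟩
    simp only [BExp.Holds, NExp.eval, h3'] at h₁ h₂
    exact ⟨⟨s'.var 5 - 1, by omega⟩, by simp; omega⟩
  · rintro s' x h3' hr h5
    rw [← hsat s' x hr h5, BExp.Holds, and_iff_right]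
    simp only [isRelay, BExp.Holds, NExp.eval, h3', h5, Fin.val_castSucc, Fin.val_succ]
    omega

theorem wp_checkConservation {P : Prop} (h3 : s.var 3 = N + 2) (hm : N + 2 ≤ m)
    (hst : Status ell y P s)
    (done : ∀ s', Frame checkConservation s s' → Status ell y ((P ∧
      ∀ i, (Constraint.conserveLe i).Sat ell y) ∧ ∀ i, (Constraint.conserveGe i).Sat ell y) s' →
      Q s') :
    WP m (input ell y) checkConservation s Q := by
  suffices h : WP m (input ell y) checkConservation s (Status ell y ((P ∧
      ∀ i, (Constraint.conserveLe i).Sat ell y) ∧ ∀ i, (Constraint.conserveGe i).Sat ell y)) from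
    h.imp fun s' hF h => done s' hF h
  refine wp_seq (wp_rowSums (G := fun i j => 1 ≤ j ∧ j ≠ i) (E := fun i j => input ell y 1 j i)
    h3 hm ?_ ?_ fun s₁ hF₁ h₁ => ?_)
  · intro s' i j _ h5 h6
    simp only [BExp.Holds, NExp.eval, h5, h6]
    omega
  · intro s' i j h5 h6 _
    simp only [NExp.eval, RExp.eval, h5, h6]
  have h3₁ := (hF₁.var 3 rfl).trans h3
  refine wp_seq (wp_rowSums (G := fun i j => j + 1 < N + 2 ∧ j ≠ i)
    (E := fun i j => input ell y 1 i j) h3₁ hm ?_ ?_ fun s₂ hF₂ h₂ => ?_)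
  · intro s' i j h3' h5 h6
    simp only [BExp.Holds, NExp.eval, h3', h5, h6]
    omega
  · intro s' i j h5 h6 _
    simp only [NExp.eval, RExp.eval, h5, h6]
  have h3₂ := (hF₂.var 3 rfl).trans h3₁
  have out : ∀ i : Fin (N + 2), s₂.real 4 i 0 = y.outflow i := by
    intro i
    rw [hF₂.real 4 rfl, h₁ i i.isLt, Finset.sum_range, Point.outflow, Finset.sum_filter]
    refine Finset.sum_congr rfl fun j _ => ?_
    have : 1 ≤ (j : ℕ) ∧ (j : ℕ) ≠ i ↔ j ≠ 0 ∧ j ≠ i := by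
      rw [Ne, Ne, Ne, Fin.ext_iff, Fin.ext_iff, Fin.val_zero, ← Ne, Nat.one_le_iff_ne_zero]
    simp only [input_F, this]
  have inn : ∀ i : Fin (N + 2), s₂.real 5 i 0 = y.inflow i := by
    intro i
    rw [h₂ i i.isLt, Finset.sum_range, Point.inflow, Finset.sum_filter]
    refine Finset.sum_congr rfl fun j _ => ?_
    have : (j : ℕ) + 1 < N + 2 ↔ j ≠ Fin.last (N + 1) := by
      rw [Ne, Fin.ext_iff, Fin.val_last]
      omega
    simp [input_F, Fin.ext_iff, this]
  have hst₂ : Status ell y P s₂ :=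
    (hst.frame hF₁ rfl rfl rfl rfl).frame hF₂ rfl rfl rfl rfl
  refine wp_seq (wp_scan_relay (fun i => .conserveLe i) h3₂ hm hst₂ ?_ (fun _ _ h₀ h₁ => ⟨h₀, h₁⟩)
    fun s₃ hF₃ h₃ => ?_)
  · intro s' x hr h5
    simp only [BExp.Holds, RExp.eval, NExp.eval, h5, hr, out, inn, Constraint.Sat]
  refine wp_scan_relay (fun i => .conserveGe i) ((hF₃.var 3 rfl).trans h3₂) hm h₃ ?_
    (fun _ _ h₀ h₁ => ⟨h₀, h₁⟩) fun s₄ _ h₄ => h₄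
  intro s' x hr h5
  simp only [BExp.Holds, RExp.eval, NExp.eval, h5, hr, hF₃.real 4 rfl, hF₃.real 5 rfl, out, inn,
    Constraint.Sat]

theorem wp_checkDegrees {P : Prop} (h3 : s.var 3 = N + 2) (hm : N + 2 ≤ m)
    (hst : Status ell y P s)
    (done : ∀ s', Frame checkDegrees s s' →
      Status ell y (P ∧ ∀ v, (Constraint.degree v).Sat ell y) s' →
      (∀ u v : Fin (N + 2 + 1), s'.real 1 u v = y.weight u v) → Q s') :
    WP m (input ell y) checkDegrees s Q := by
  suffices h : WP m (input ell y) checkDegrees s fun s' =>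
      Status ell y (P ∧ ∀ v, (Constraint.degree v).Sat ell y) s' ∧
      ∀ u v : Fin (N + 2 + 1), s'.real 1 u v = y.weight u v from
    h.imp fun s' hF h => done s' hF h.1 h.2
  refine wp_seq (wp_pairLoop_fill (a := 1) (E := fun i j => if i < j then input ell y 3 i j else
    if j < i then input ell y 3 j i else 0) h3 hm (fun _ => rfl) (by simp) (by simp) ?_ ?_
    fun s₁ hF₁ h₁ => ?_)
  · intro a ha
    simp [fillPairWeight, Prog.keepsReal, natBeq_eq_false ha.symm]
  · intro s' i j Q' h5 h6 _ _ hQ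
    refine wp_cond (fun h => wp_setReal ?_) fun h => wp_cond (fun h' => wp_setReal ?_)
      fun h' => wp_setReal ?_ <;>
    simp only [BExp.Holds, NExp.eval, RExp.eval, h5, h6, Nat.add_one_le_iff] at *
    · rwa [if_pos h] at hQ
    · rwa [if_neg h, if_pos h'] at hQ
    · rwa [if_neg h, if_neg h'] at hQ
  have h3₁ := (hF₁.var 3 rfl).trans h3
  have pw : ∀ i j : Fin (N + 2), s₁.real 1 i j = y.pairWeight i j := by
    intro i j
    rw [h₁ i i.isLt j j.isLt, Point.pairWeight, input_lamHat, input_lamHat]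
    rfl
  refine wp_seq (wp_rowSums (G := fun _ _ => True) (E := fun i j => s₁.real 1 i j) h3₁ hm ?_ ?_
    fun s₂ hF₂ h₂ => ?_)
  · intro s' i j _ _ _
    simp [BExp.Holds, NExp.eval]
  · intro s' i j h5 h6 h
    simp only [NExp.eval, RExp.eval, h5, h6, h 1 (by simp)]
  have h3₂ := (hF₂.var 3 rfl).trans h3₁
  have hst₂ : Status ell y P s₂ :=
    (hst.frame hF₁ rfl rfl rfl rfl).frame hF₂ rfl rfl rfl rfl
  have load : ∀ i : Fin (N + 2), s₂.real 6 i 0 = y.load i := by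
    intro i
    rw [h₂ i i.isLt, Finset.sum_range, Point.load]
    simp only [if_true, pw]
  refine wp_seq (wp_scan_family (fun v => .degree v) (fun v i _ => i = v.val) h3₂ hm hst₂
    (fun v => ⟨v, v.isLt, 0, by simp, rfl⟩) (fun s' _ h5 _ _ => ⟨⟨_, h5⟩, rfl⟩) ?_
    (fun _ _ h₀ h₁ => ⟨h₀, h₁⟩) fun s₃ hF₃ h₃ => ?_)
  · intro s' v _ hr h5
    rw [Constraint.sat_degree_iff]
    simp only [BExp.Holds, RExp.eval, NExp.eval, h5, hr, load]
  have h3₃ := (hF₃.var 3 rfl).trans h3₂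
  have pw₃ : ∀ i j : Fin (N + 2), s₃.real 1 i j = y.pairWeight i j := by
    intro i j
    rw [hF₃.real 1 rfl, hF₂.real 1 rfl, pw]
  have load₃ : ∀ i : Fin (N + 2), s₃.real 6 i 0 = y.load i := by
    intro i
    rw [hF₃.real 6 rfl, load]
  refine wp_seq (wp_forLoop (fun k s' => (∀ i j : Fin (N + 2), s'.real 1 i j = y.pairWeight i j) ∧
    ∀ i : Fin (N + 2), i.val < k → s'.real 1 i (N + 2) = 1 - y.load i ∧
      s'.real 1 (N + 2) i = 1 - y.load i) h3₃ hm rfl rfl ⟨pw₃, by simp⟩ ?_ ?_)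
  · intro k s' hk h5 hF hJ
    have h3' := (hF.var 3 rfl).trans h3₃
    have hl : s'.real 6 k 0 = 1 - (1 - y.load ⟨k, hk⟩) := by
      rw [hF.real 6 rfl, load₃ ⟨k, hk⟩]
      ring
    refine wp_seq (wp_setReal (wp_setReal ⟨fun i j => ?_, fun i hi => ?_⟩))
    · simp [NExp.eval, RExp.eval, h5, h3', hJ.1 i j, i.isLt.ne, j.isLt.ne]
    · rcases Nat.lt_succ_iff_lt_or_eq.1 hi with h | h
      · simp [NExp.eval, RExp.eval, h5, h3', hJ.2 i h, i.isLt.ne, h.ne]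
      · obtain rfl : i = ⟨k, hk⟩ := Fin.ext h
        simp [NExp.eval, RExp.eval, h5, h3', hl, hk.ne]
  · intro s₄ hF₄ hJ
    have h3₄ := (hF₄.var 3 rfl).trans h3₃
    -- The remaining programs write only to the real array `1`, so the status after the degree scan
    -- persists.
    refine wp_setReal ⟨h₃.frame (c := .seq (.forLoop 5 3 fillSlack)
      (.setReal 1 (.var 3) (.var 3) .zero)) (hF₄.mono ?_ ?_ ?_ |>.trans ?_) rfl rfl rfl rfl, ?_⟩
    · simp +contextual [Prog.keepsVar]
    · simp +contextual [Prog.keepsNat]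
    · simp +contextual [Prog.keepsReal]
    · exact (Exec.setReal (I := input ell y) s₄ 1 (.var 3) (.var 3) .zero).frame.mono
        (by simp +contextual [Prog.keepsVar])
        (by simp +contextual [Prog.keepsNat]) (by simp +contextual [Prog.keepsReal])
    · intro u v
      simp only [NExp.eval, RExp.eval, h3₄, State.putReal_real, true_and]
      induction u using Fin.lastCases <;> induction v using Fin.lastCases
      · simp
      · rename_i v
        simp [(hJ.2 v v.isLt).2, v.isLt.ne]
      · rename_i u
        simp [(hJ.2 u u.isLt).1, u.isLt.ne]
      · rename_i u v
        simp [hJ.1 u v, u.isLt.ne]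

end specifications

end OneTwoOne

/-! ## The minimum cut program -/

namespace OneTwoOne

open RealRAM OddCut PushRelabel

section programs

/-- The label of the vertex in variable `x`. -/
abbrev labelOf (x : ℕ) : NExp := .get 1 (.var x) (.lit 0)

/-- Initial residual capacity of the arc from variable `5` to variable `6`; the source is in
variable `7`. -/
def initArc : Prog :=
  .cond (natEq (.var 5) (.var 7)) (.setReal 2 (.var 5) (.var 6) .zero)
    (.cond (natEq (.var 6) (.var 7)) (.setReal 2 (.var 5) (.var 6)
      (.add (.get 1 (.var 5) (.var 6)) (.get 1 (.var 6) (.var 5))))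
      (.setReal 2 (.var 5) (.var 6) (.get 1 (.var 5) (.var 6))))

/-- Initial excess and label of the vertex in variable `5`. -/
def initVertex : Prog :=
  .seq (.setReal 3 (.var 5) (.lit 0) (.get 1 (.var 7) (.var 5)))
    (.cond (natEq (.var 5) (.var 7)) (.setNat 1 (.var 5) (.lit 0) (.var 4))
      (.setNat 1 (.var 5) (.lit 0) (.lit 0)))

/-- Put the amount to be pushed from variable `5` to variable `6` into cell `(0, 0)` of array
`0`. -/
def pushAmount : Prog :=
  .cond (.realLe (.get 3 (.var 5) (.lit 0)) (.get 2 (.var 5) (.var 6)))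
    (.setReal 0 (.lit 0) (.lit 0) (.get 3 (.var 5) (.lit 0)))
    (.setReal 0 (.lit 0) (.lit 0) (.get 2 (.var 5) (.var 6)))

/-- Push as much as possible from variable `5` to variable `6`. -/
def pushArc : Prog :=
  .seq pushAmount
  (.seq (.setReal 2 (.var 5) (.var 6)
    (.sub (.get 2 (.var 5) (.var 6)) (.get 0 (.lit 0) (.lit 0))))
  (.seq (.setReal 2 (.var 6) (.var 5)
    (.add (.get 2 (.var 6) (.var 5)) (.get 0 (.lit 0) (.lit 0))))
  (.seq (.setReal 3 (.var 5) (.lit 0)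
    (.sub (.get 3 (.var 5) (.lit 0)) (.get 0 (.lit 0) (.lit 0))))
  (.seq (.setReal 3 (.var 6) (.lit 0)
    (.add (.get 3 (.var 6) (.lit 0)) (.get 0 (.lit 0) (.lit 0))))
  (.setVar 11 (.lit 1))))))

/-- The arc from variable `5` to variable `6` is admissible. -/
def isAdmissible : BExp :=
  .and (.natLt (labelOf 5) (.var 4)) (.and (natEq (labelOf 5) (.add (labelOf 6) (.lit 1)))
    (.realLt .zero (.get 2 (.var 5) (.var 6))))

/-- If the arc from variable `5` to variable `6` is admissible, note this in variable `12` and push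
if there is an excess. -/
def treatArc : Prog :=
  .cond isAdmissible (.seq (.setVar 12 (.lit 1))
    (.cond (.realLt .zero (.get 3 (.var 5) (.lit 0))) pushArc .nop)) .nop

/-- Relabel variable `5` if variable `12` shows no admissible arc. -/
def treatVertex : Prog :=
  .cond (.and (.natLe (.var 12) (.lit 0)) (.and (.natLt (labelOf 5) (.var 4))
    (.neg (natEq (.var 5) (.var 8)))))
    (.seq (.setNat 1 (.var 5) (.lit 0) (.add (labelOf 5) (.lit 1))) (.setVar 11 (.lit 1))) .nop

/-- One round of pushing and relabelling; variable `11` tells whether anything happened. -/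
def pushRelabelRound : Prog :=
  .seq (.setVar 11 (.lit 0)) (.forLoop 5 4 (.seq (.setVar 12 (.lit 0))
    (.seq (.forLoop 6 4 treatArc) treatVertex)))

/-- Compute the minimum cut that separates the vertex in variable `8` from the one in variable
`7`. -/
def minCutProg : Prog :=
  .seq (pairLoop 4 initArc) (.seq (.forLoop 5 4 initVertex)
    (.seq (.setVar 11 (.lit 1)) (.loop (.natLe (.lit 1) (.var 11)) pushRelabelRound)))

end programs

/-! ### Correctness of the push-relabel program -/

section specifications

variable {M m : ℕ} {I : Input} {s : State} {Q : State → Prop} {w : Fin M → Fin M → ℝ}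
  {a b u v : Fin M}

/-- The memory holds a preflow with a valid labelling. -/
def HoldsPreflow (w : Fin M → Fin M → ℝ) (a b : Fin M) (s : State) : Prop :=
  Inv w a b (fun u v => s.real 2 u v) (fun v => s.real 3 v 0) fun v => s.nat 1 v 0

/-- The potential of the preflow in the memory. -/
noncomputable def statePotential (M : ℕ) (s : State) : ℕ :=
  potential (fun u v : Fin M => s.real 2 u v) (fun v : Fin M => s.real 3 v 0)
    fun v : Fin M => s.nat 1 v 0

/-- The arc from `u` to `v` is admissible. -/
def Admissible (M : ℕ) (s : State) (u v : ℕ) : Prop :=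
  s.nat 1 u 0 < M ∧ s.nat 1 u 0 = s.nat 1 v 0 + 1 ∧ 0 < s.real 2 u v

/-- Nothing can be pushed out of `u`, and `u` cannot be relabelled. -/
def StableAt (b : Fin M) (s : State) (u : ℕ) : Prop :=
  (∀ v < M, Admissible M s u v → s.real 3 u 0 ≤ 0) ∧
    (u ≠ b → s.nat 1 u 0 < M → ∃ v < M, Admissible M s u v)

theorem HoldsPreflow.congr {s' : State} (h : HoldsPreflow w a b s)
    (h2 : s'.real 2 = s.real 2) (h3 : s'.real 3 = s.real 3) (h1 : s'.nat 1 = s.nat 1) :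
    HoldsPreflow w a b s' := by
  rwa [HoldsPreflow, h2, h3, h1]

theorem HoldsPreflow.isMinCut (h : HoldsPreflow w a b s) (hw : ∀ u v, w u v = w v u)
    (hs : ∀ u < M, StableAt b s u) :
    IsMinCut (cut w) b a (Finset.univ.filter fun v : Fin M => s.nat 1 v 0 < M) := by
  have := Inv.isMinCut h hw (fun u v h₁ h₂ h₃ => (hs u u.isLt).1 v v.isLt
    ⟨by simpa using h₁, h₃, h₂⟩) (fun u hu h₁ => by
      obtain ⟨v, hv, hadm⟩ := (hs u u.isLt).2 (fun h => hu (Fin.ext h)) (by simpa using h₁)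
      exact ⟨⟨v, hv⟩, hadm.2.2, hadm.2.1⟩)
  simpa using this

theorem wp_pushArc (hinv : HoldsPreflow w a b s) (h5 : s.var 5 = u) (h6 : s.var 6 = v)
    (hadm : Admissible M s u v) (he : 0 < s.real 3 u 0)
    (done : ∀ s', HoldsPreflow w a b s' → statePotential M s' < statePotential M s →
      s'.var 11 = 1 → s'.var 12 = s.var 12 → Q s') : WP m I pushArc s Q := by
  obtain ⟨hl, hd, hc⟩ := hadm
  have hne : u ≠ v := by rintro rfl; omega
  have hne' : (u : ℕ) ≠ v := fun h => hne (Fin.ext h)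
  -- The amount is the minimum of excess and residual capacity, so it exhausts one of the two.
  have amount : WP m I pushAmount s fun s' => ∃ δ, s' = s.putReal 0 0 0 δ ∧ 0 < δ ∧
      δ ≤ s.real 3 u 0 ∧ δ ≤ s.real 2 u v ∧ (δ = s.real 3 u 0 ∨ δ = s.real 2 u v) := by
    refine wp_cond (fun h => wp_setReal ?_) fun h => wp_setReal ?_ <;>
      simp only [BExp.Holds, RExp.eval, NExp.eval, h5, h6, not_le] at h ⊢
    · exact ⟨_, rfl, he, le_rfl, h, Or.inl rfl⟩
    · exact ⟨_, rfl, hc, h.le, le_rfl, Or.inr rfl⟩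
  refine wp_seq (amount.imp fun s₁ _ ⟨δ, hs₁, h₀, he', hc', hδ⟩ => ?_)
  subst hs₁
  refine wp_seq (wp_setReal (wp_seq (wp_setReal (wp_seq (wp_setReal (wp_seq (wp_setReal
    (wp_setVar (done _ ?_ ?_ ?_ ?_)))))))))
  rotate_left 2
  · simp [NExp.eval]
  · simp
  all_goals
    simp only [HoldsPreflow, statePotential, NExp.eval, RExp.eval, State.putReal_real,
      State.putReal_var, State.putReal_nat, State.putVar_real, State.putVar_nat, h5, h6]
    -- The later write is tested first; since `u ≠ v` the two writes do not interfere.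
    have r₂ : (fun x y : Fin M => if (2 : ℕ) = 2 ∧ (x : ℕ) = v ∧ (y : ℕ) = u then
        s.real 2 v u + δ else if (2 : ℕ) = 2 ∧ (x : ℕ) = u ∧ (y : ℕ) = v then
        s.real 2 u v - δ else s.real 2 x y) =
        pushResidual (fun x y : Fin M => s.real 2 x y) u v δ := by
      funext x y
      rw [pushResidual]
      by_cases h₁ : x = u
      · subst h₁
        simp [hne', Fin.ext_iff]
      · have h₁' : (x : ℕ) ≠ u := fun h => h₁ (Fin.ext h)
        simp [h₁', Fin.ext_iff]
    have r₃ : (fun x : Fin M => if (3 : ℕ) = 3 ∧ (x : ℕ) = v ∧ (0 : ℕ) = 0 then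
        s.real 3 v 0 + δ else if (3 : ℕ) = 3 ∧ (x : ℕ) = u ∧ (0 : ℕ) = 0 then
        s.real 3 u 0 - δ else s.real 3 x 0) =
        pushExcess (fun x : Fin M => s.real 3 x 0) u v δ := by
      funext x
      rw [pushExcess]
      by_cases h₁ : x = u
      · subst h₁
        simp [hne']
      · have h₁' : (x : ℕ) ≠ u := fun h => h₁ (Fin.ext h)
        simp [h₁', Fin.ext_iff]
    simp [hne', hne'.symm] at r₂ r₃ ⊢
    rw [r₂, r₃]
  · exact Inv.push hinv (by simpa using hl) hd h₀.le he' hc'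
  · exact Inv.potential_push hinv (by simpa using hl) hd h₀ he' hc' hδ

/-- The memory `s'` agrees with `s` on the preflow and the labels. -/
def SamePreflow (s s' : State) : Prop :=
  s'.real 2 = s.real 2 ∧ s'.real 3 = s.real 3 ∧ s'.nat 1 = s.nat 1

theorem SamePreflow.admissible {s' : State} (h : SamePreflow s s') (u v : ℕ) :
    Admissible M s' u v ↔ Admissible M s u v := by
  rw [Admissible, Admissible, h.1, h.2.2]

theorem SamePreflow.stableAt {s' : State} (h : SamePreflow s s') (u : ℕ) :
    StableAt b s' u ↔ StableAt b s u := by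
  simp only [StableAt, h.admissible]
  rw [h.2.1, h.2.2]

/-- The memory holds a preflow of potential at most `p`, and less if variable `11` is set. -/
def Progress (w : Fin M → Fin M → ℝ) (a b : Fin M) (p : ℕ) (s : State) : Prop :=
  HoldsPreflow w a b s ∧ s.var 11 ≤ 1 ∧ statePotential M s + s.var 11 ≤ p

theorem Progress.congr {p : ℕ} {s' : State} (h : Progress w a b p s) (hs : SamePreflow s s')
    (h11 : s'.var 11 = s.var 11) : Progress w a b p s' := by
  have hpot : statePotential M s' = statePotential M s := by
    rw [statePotential, statePotential, hs.1, hs.2.1, hs.2.2]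
  exact ⟨h.1.congr hs.1 hs.2.1 hs.2.2, by rw [h11]; exact h.2.1, by rw [hpot, h11]; exact h.2.2⟩

theorem wp_treatArc {p : ℕ} (hp : Progress w a b p s) (h4 : s.var 4 = M) (h5 : s.var 5 = u)
    (h6 : s.var 6 = v)
    (pushed : ∀ s', Progress w a b p s' → s'.var 11 = 1 → s'.var 12 = 1 → Q s')
    (kept : ∀ s', SamePreflow s s' → s'.var 11 = s.var 11 → s'.var 12 = 1 →
      Admissible M s u v → s.real 3 u 0 ≤ 0 → Q s')
    (skipped : ¬ Admissible M s u v → Q s) :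
    WP m I treatArc s Q := by
  have hadm : isAdmissible.Holds I s ↔ Admissible M s u v := by
    simp only [isAdmissible, BExp.Holds, NExp.eval, RExp.eval, h4, h5, h6, Admissible, not_le,
      Nat.add_one_le_iff]
    refine and_congr_right fun _ => and_congr_left fun _ => ?_
    omega
  refine wp_cond (fun h => ?_) fun h => wp_nop (skipped (hadm.not.1 h))
  have hA := hadm.1 h
  refine wp_seq (wp_setVar (wp_cond (fun h' => ?_) fun h' => wp_nop ?_))
  · simp only [BExp.Holds, RExp.eval, NExp.eval, not_le, State.putVar_real, State.putVar_var] at h'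
    refine wp_pushArc (hp.1.congr rfl rfl rfl) (by simpa using h5) (by simpa using h6) hA
      (by simpa [h5] using h') fun s' h₁ h₂ h₃ h₄ => pushed s' ⟨h₁, h₃.le, ?_⟩ h₃ ?_
    · have h₅ : statePotential M s' < statePotential M s := h₂
      have := hp.2.2
      omega
    · rw [h₄]
      simp [NExp.eval]
  · refine kept _ ⟨rfl, rfl, rfl⟩ (by simp) (by simp [NExp.eval]) hA ?_
    simpa [BExp.Holds, RExp.eval, NExp.eval, h5] using h'

/-- Vertices are relabelled whether or not they have excess. At the end every vertex of label below
`M` other than the sink therefore has an admissible arc, as `Inv.isMinCut` requires. -/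
theorem wp_treatVertex {p : ℕ} (hp : Progress w a b p s) (h4 : s.var 4 = M) (h5 : s.var 5 = u)
    (h8 : s.var 8 = b) (hadm : s.var 12 = 0 → ∀ v < M, ¬ Admissible M s u v)
    (relabelled : ∀ s', Progress w a b p s' → s'.var 11 = 1 → Q s')
    (kept : ((u : ℕ) ≠ b → s.nat 1 u 0 < M → s.var 12 ≠ 0) → Q s) :
    WP m I treatVertex s Q := by
  refine wp_cond (fun h => ?_) fun h => wp_nop (kept fun hub hl h12 => h ?_)
  · simp only [BExp.Holds, NExp.eval, h4, h5, h8, ← le_antisymm_iff, Nat.le_zero,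
      Nat.add_one_le_iff] at h
    obtain ⟨h12, hl, hub⟩ := h
    have hd : (fun x : Fin M => (s.putNat 1 u 0 (s.nat 1 u 0 + 1)).nat 1 x 0) =
        relabel (fun x : Fin M => s.nat 1 x 0) u := by
      funext x
      simp [relabel, Fin.ext_iff]
    refine wp_seq (wp_setNat (wp_setVar (relabelled _ ⟨?_, ?_, ?_⟩ ?_)))
    rotate_left
    · simp [NExp.eval]
    · have h₁ : statePotential M (s.putNat 1 u 0 (s.nat 1 u 0 + 1)) < statePotential M s := by
        have := potential_relabel (c := fun x y : Fin M => s.real 2 x y)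
          (e := fun x : Fin M => s.real 3 x 0) (d := fun x : Fin M => s.nat 1 x 0) (u := u)
          (by simpa using hl)
        rw [statePotential, hd]
        exact this
      have h₂ := hp.2.2
      have h₃ : statePotential M ((s.putNat 1 u 0 (s.nat 1 u 0 + 1)).putVar 11 1) =
        statePotential M (s.putNat 1 u 0 (s.nat 1 u 0 + 1)) := rfl
      simp only [NExp.eval, h5, h₃, State.putVar_var, if_true]
      omega
    · simp [NExp.eval]
    · have h₁ := Inv.relabel hp.1 (u := u) (by simpa using hl) (fun h => hub (by rw [h]))
        fun v hv hd => hadm h12 v v.isLt ⟨hl, hd, hv⟩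
      simp only [HoldsPreflow, NExp.eval, h5, State.putVar_nat, hd]
      exact h₁
  · simp only [BExp.Holds, NExp.eval, h4, h5, h8, ← le_antisymm_iff, Nat.le_zero,
      Nat.add_one_le_iff]
    exact ⟨h12, hl, hub⟩

theorem wp_pushRelabelRound (hinv : HoldsPreflow w a b s) (h4 : s.var 4 = M) (h8 : s.var 8 = b)
    (hm : M ≤ m)
    (done : ∀ s', Frame pushRelabelRound s s' → Progress w a b (statePotential M s) s' →
      (s'.var 11 = 0 → ∀ u < M, StableAt b s' u) → Q s') :
    WP m I pushRelabelRound s Q := by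
  set p := statePotential M s with hp
  suffices h : WP m I pushRelabelRound s fun s' => Progress w a b p s' ∧
      (s'.var 11 = 0 → ∀ u < M, StableAt b s' u) from h.imp fun s' hF h => done s' hF h.1 h.2
  refine wp_seq (wp_setVar ?_)
  have start : Progress w a b p (s.putVar 11 0) :=
    ⟨hinv, by simp, by simp [statePotential, hp]⟩
  refine wp_forLoop (fun k s' => Progress w a b p s' ∧
    (s'.var 11 = 0 → ∀ u < k, StableAt b s' u)) (by simpa using h4) hm rfl rfl
    ⟨start.congr ⟨rfl, rfl, rfl⟩ rfl, by simp⟩ ?_ fun s' _ h => h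
  rintro u s₁ hu h5 hF ⟨hp₁, hst₁⟩
  lift u to Fin M using hu
  have h4₁ : s₁.var 4 = M := (hF.var 4 rfl).trans (by simpa using h4)
  have h8₁ : s₁.var 8 = b := (hF.var 8 rfl).trans (by simpa using h8)
  refine wp_seq (wp_setVar (wp_seq ?_))
  -- Stability statements are claimed only while variable `11` is 0, that is, while nothing has
  -- changed in this round. The absence of admissible arcs is tied to variable `12` alone: if it is
  -- 0, no push has occurred in this inner loop, whatever happened at earlier vertices.
  refine wp_forLoop (fun k s' => Progress w a b p s' ∧
    (s'.var 11 = 0 → ∀ u' < (u : ℕ), StableAt b s' u') ∧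
    (s'.var 11 = 0 → ∀ v < k, Admissible M s' u v → s'.real 3 u 0 ≤ 0) ∧
    (s'.var 12 = 0 → ∀ v < k, ¬ Admissible M s' u v) ∧
    (s'.var 12 ≠ 0 → s'.var 11 = 0 → ∃ v < M, Admissible M s' u v)) (by simpa using h4₁) hm rfl rfl
    ⟨hp₁.congr ⟨rfl, rfl, rfl⟩ rfl, hst₁, by simp, by simp, by simp [NExp.eval]⟩ ?_ ?_
  · rintro v s₂ hv h6 hF₂ ⟨hp₂, hst₂, hex₂, hno₂, hyes₂⟩
    lift v to Fin M using hv
    refine wp_treatArc hp₂ ((hF₂.var 4 rfl).trans (by simpa using h4₁))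
      ((hF₂.var 5 rfl).trans (by simpa using h5)) h6 ?_ ?_ ?_
    · intro s' hp' h11 h12
      refine ⟨hp'.congr ⟨rfl, rfl, rfl⟩ rfl, ?_, ?_, ?_, ?_⟩ <;> simp [h11, h12]
    · intro s' hs h11 h12 hadm he
      have hs' : SamePreflow s₂ (s'.putVar 6 (v + 1)) := hs
      have h11' : (s'.putVar 6 (v + 1)).var 11 = s₂.var 11 := by simpa using h11
      refine ⟨hp₂.congr hs' h11', ?_, ?_, ?_, ?_⟩
      · simp only [hs'.stableAt, h11']
        exact hst₂
      · rw [hs'.2.1]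
        exact fun _ _ _ _ => he
      · simp [h12]
      · simp only [hs'.admissible]
        exact fun _ _ => ⟨v, v.isLt, hadm⟩
    · intro hadm
      refine ⟨hp₂.congr ⟨rfl, rfl, rfl⟩ rfl, hst₂, fun h11 v' hv' => ?_, fun h12 v' hv' => ?_, hyes₂⟩
      · rcases Nat.lt_succ_iff_lt_or_eq.1 hv' with h | rfl
        · exact hex₂ h11 v' h
        · exact fun h => absurd h hadm
      · rcases Nat.lt_succ_iff_lt_or_eq.1 hv' with h | rfl
        · exact hno₂ h12 v' h
        · exact hadm
  · rintro s₂ hF₂ ⟨hp₂, hst₂, hex₂, hno₂, hyes₂⟩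
    refine wp_treatVertex hp₂ ((hF₂.var 4 rfl).trans (by simpa using h4₁))
      ((hF₂.var 5 rfl).trans (by simpa using h5)) ((hF₂.var 8 rfl).trans (by simpa using h8₁))
      hno₂ ?_ ?_
    · intro s' hp' h11
      exact ⟨hp'.congr ⟨rfl, rfl, rfl⟩ rfl, by simp [h11]⟩
    · intro hk
      refine ⟨hp₂.congr ⟨rfl, rfl, rfl⟩ rfl, fun h11 u' hu' => ?_⟩
      rcases Nat.lt_succ_iff_lt_or_eq.1 hu' with h | rfl
      · exact hst₂ h11 u' h
      · exact ⟨hex₂ h11, fun hub hl => hyes₂ (hk hub hl) h11⟩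

/-- A bound for the number of rounds of every loop on a graph with `M` vertices. -/
def roundBound (M : ℕ) : ℕ :=
  ((M + 1) * M + 2) * M ^ 2 + (M + 1) * M ^ 2 + M ^ 2 + 1 + M

theorem wp_minCutProg (hw : ∀ u v, 0 ≤ w u v) (hw₀ : ∀ u, w u u = 0)
    (hsymm : ∀ u v, w u v = w v u) (hab : a ≠ b) (h4 : s.var 4 = M) (h7 : s.var 7 = a)
    (h8 : s.var 8 = b) (hW : ∀ u v : Fin M, s.real 1 u v = w u v) (hm : roundBound M ≤ m)
    (done : ∀ s', Frame minCutProg s s' → IsMinCut (cut w) b a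
      (Finset.univ.filter fun v : Fin M => s'.nat 1 v 0 < M) → Q s') :
    WP m I minCutProg s Q := by
  suffices h : WP m I minCutProg s fun s' => IsMinCut (cut w) b a
      (Finset.univ.filter fun v : Fin M => s'.nat 1 v 0 < M) from
    h.imp fun s' hF h => done s' hF h
  have hM : M ≤ m := le_trans (by rw [roundBound]; omega) hm
  refine wp_seq (wp_pairLoop_fill (a := 2) (E := fun i j => if i = a then 0 else
    if j = a then s.real 1 i j + s.real 1 j i else s.real 1 i j) h4 hM (fun _ => rfl) (by simp)
    (by simp) ?_ ?_ fun s₁ hF₁ h₁ => ?_)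
  · intro a ha
    simp [initArc, Prog.keepsReal, natBeq_eq_false ha.symm]
  · intro s' i j Q' h5 h6 hv hr hQ
    have h7' := (hv 7 (by simp) (by simp)).trans h7
    refine wp_cond (fun h => wp_setReal ?_) fun h => wp_cond (fun h' => wp_setReal ?_)
      fun h' => wp_setReal ?_ <;>
    simp only [BExp.Holds, NExp.eval, RExp.eval, h5, h6, h7', ← le_antisymm_iff,
      hr 1 (by simp)] at *
    · rwa [if_pos h] at hQ
    · rwa [if_neg h, if_pos h'] at hQ
    · rwa [if_neg h, if_neg h'] at hQ
  have h4₁ := (hF₁.var 4 rfl).trans h4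
  refine wp_seq (wp_forLoop (fun k s' => ∀ i < k, s'.real 3 i 0 = s.real 1 a i ∧
    s'.nat 1 i 0 = if i = a then M else 0) h4₁ hM rfl rfl (by simp) ?_ ?_)
  · intro k s' _ h5 hF hJ
    have h4' := (hF.var 4 rfl).trans h4₁
    have h7' := (hF.var 7 rfl).trans ((hF₁.var 7 rfl).trans h7)
    have h1' := (hF.real 1 rfl).trans (hF₁.real 1 rfl)
    refine wp_seq (wp_setReal (wp_cond (fun h => wp_setNat ?_) fun h => wp_setNat ?_)) <;>
    · simp only [BExp.Holds, NExp.eval, RExp.eval, h5, h7', h4', h1', ← le_antisymm_iff,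
        State.putReal_var] at h ⊢
      intro i hi
      rcases Nat.lt_succ_iff_lt_or_eq.1 hi with hi | rfl
      · simpa [hi.ne] using hJ i hi
      · simp [h]
  intro s₂ hF₂ h₂
  have hinv : HoldsPreflow w a b s₂ := by
    have := Inv.init hw hw₀ hab
    rw [HoldsPreflow]
    convert this using 1
    · funext i j
      rw [hF₂.real 2 rfl, h₁ i i.isLt j j.isLt, hW, hW]
      simp only [Fin.ext_iff]
    · funext i
      rw [(h₂ i i.isLt).1, hW]
    · funext i
      rw [(h₂ i i.isLt).2, Fintype.card_fin]
      simp only [Fin.ext_iff]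
  have h4₂ := (hF₂.var 4 rfl).trans h4₁
  have h8₂ := (hF₂.var 8 rfl).trans ((hF₁.var 8 rfl).trans h8)
  refine wp_seq (wp_setVar ?_)
  -- The extra 1 pays for variable `11`, which is set to force the first round.
  have hpot : statePotential M (s₂.putVar 11 1) + 1 ≤ m := by
    refine le_trans (Nat.add_le_add_right (potential_le _ _ _ hinv.label_le) 1) (le_trans ?_ hm)
    rw [Fintype.card_fin, roundBound]
    omega
  -- The variant bounds potential plus variable `11`. A round starts with that variable equal to 1
  -- and ends with the sum at most the old potential.
  refine wp_loop (J := fun k s' => s'.var 4 = M ∧ s'.var 8 = b ∧ Progress w a b k s' ∧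
    (s'.var 11 = 0 → ∀ u < M, StableAt b s' u)) ?_ ?_ hpot
    ⟨by simpa using h4₂, by simpa using h8₂, ⟨hinv, by simp [NExp.eval], by simp [NExp.eval]⟩,
      by simp [NExp.eval]⟩
  · rintro k s' ⟨h4', h8', hp, _⟩ hpos
    refine wp_pushRelabelRound hp.1 h4' h8' hM fun s'' hF' hp' hst => ⟨_, ?_,
      (hF'.var 4 rfl).trans h4', (hF'.var 8 rfl).trans h8', hp', hst⟩
    simp only [BExp.Holds, NExp.eval] at hpos
    have := hp.2.2
    omega
  · rintro k s' ⟨_, _, hp, hst⟩ hneg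
    simp only [BExp.Holds, NExp.eval] at hneg
    exact hp.1.isMinCut hsymm (hst (by omega))

end specifications

end OneTwoOne

/-! ## The separation algorithm -/

namespace OneTwoOne

open RealRAM OddCut

section programs

/-- Enter into array `0` whether variable `5` and the extra vertex are on different sides of the
cut. -/
def markNode : Prog :=
  .cond (.natLt (labelOf 5) (.var 4))
    (.cond (.natLt (labelOf 3) (.var 4)) (.setNat 0 (.var 5) (.lit 0) (.lit 0))
      (.setNat 0 (.var 5) (.lit 0) (.lit 1)))
    (.cond (.natLt (labelOf 3) (.var 4)) (.setNat 0 (.var 5) (.lit 0) (.lit 1))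
      (.setNat 0 (.var 5) (.lit 0) (.lit 0)))

/-- The variable `x` holds an element of the set in array `0`. -/
abbrev isMarked (x : ℕ) : BExp := .natLe (.lit 1) (.get 0 (.var x) (.lit 0))

/-- Toggle the parity for variable `5` and add up its share in the odd-set constraint. -/
def addMember : Prog :=
  .seq (.setVar 13 (.sub (.lit 1) (.var 13)))
  (.seq (.setReal 0 (.lit 0) (.lit 0) (.sub (.get 0 (.lit 0) (.lit 0)) .one))
  (.forLoop 6 3 (.cond (isMarked 6) (.setReal 0 (.lit 0) (.lit 0)
    (.add (.get 0 (.lit 0) (.lit 0)) (.get 1 (.var 5) (.var 6)))) .nop)))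

/-- Answer with the odd-set constraint of the set in array `0` if it is violated. -/
def testOddSet : Prog :=
  .seq (.setVar 13 (.lit 0)) (.seq (.setReal 0 (.lit 0) (.lit 0) .one)
  (.seq (.forLoop 5 3 (.cond (isMarked 5) addMember .nop))
  (.cond (.and (.natLe (.lit 1) (.var 13)) (.realLt .zero (.get 0 (.lit 0) (.lit 0))))
    (.setVar 0 (.lit 9)) .nop)))

/-- Unless an answer has been found, test the minimum cut for the vertices in variables `7`
and `8`. -/
def treatPair : Prog :=
  .cond (.and (.natLe (.var 0) (.lit 0)) (.neg (natEq (.var 7) (.var 8))))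
    (.seq minCutProg (.seq (.forLoop 5 3 markNode) testOddSet)) .nop

/-- Check the odd-set constraints. -/
def checkOddSets : Prog := .forLoop 7 4 (.forLoop 8 4 treatPair)

/-- The separation algorithm. -/
def separation : Prog :=
  .seq prepare (.seq checkLinks (.seq checkConservation (.seq checkDegrees checkOddSets)))

end programs

/-! ### Correctness of the odd-set test and of the whole algorithm -/

section specifications

variable {N : ℕ} {ell : Network N} {y : Point N} {m : ℕ} {I : Input} {s : State}
  {Q : State → Prop}

theorem wp_testOddSet {S : Finset (Fin (N + 2))} (h3 : s.var 3 = N + 2) (hm : N + 2 ≤ m)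
    (h0 : s.var 0 = 0) (hS : ∀ v : Fin (N + 2), s.nat 0 v 0 = if v ∈ S then 1 else 0)
    (hW : ∀ u v : Fin (N + 2), s.real 1 u v = y.pairWeight u v)
    (done : ∀ s', Frame testOddSet s s' → s'.var 0 = 9 →
      Odd S.card → 0 < 1 - (S.card : ℝ) + ∑ u ∈ S, ∑ v ∈ S, y.pairWeight u v → Q s')
    (skip : ∀ s', Frame testOddSet s s' → s'.var 0 = 0 →
      (Odd S.card → 1 - (S.card : ℝ) + ∑ u ∈ S, ∑ v ∈ S, y.pairWeight u v ≤ 0) → Q s') :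
    WP m I testOddSet s Q := by
  classical
  suffices h : WP m I testOddSet s fun s' =>
      (s'.var 0 = 9 ∧ Odd S.card ∧
        0 < 1 - (S.card : ℝ) + ∑ u ∈ S, ∑ v ∈ S, y.pairWeight u v) ∨
      (s'.var 0 = 0 ∧ (Odd S.card → 1 - (S.card : ℝ) + ∑ u ∈ S, ∑ v ∈ S, y.pairWeight u v ≤ 0))
    from h.imp fun s' hF h => h.elim (fun h => done s' hF h.1 h.2.1 h.2.2)
      fun h => skip s' hF h.1 h.2
  have marked : ∀ v : Fin (N + 2), 1 ≤ s.nat 0 v 0 ↔ v ∈ S := by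
    intro v
    rw [hS]
    split_ifs with h <;> simp [h]
  refine wp_seq (wp_setVar (wp_seq (wp_setReal (wp_seq ?_))))
  -- Variable `13` is the parity of the members met so far; the real cell accumulates the left side
  -- of the doubled constraint as in `Constraint.sat_oddSet_iff`.
  refine wp_forLoop (fun k s' => s'.var 13 = (∑ i ∈ Finset.range k, s.nat 0 i 0) % 2 ∧
    s'.real 0 0 0 = 1 + ∑ i ∈ Finset.range k, if 1 ≤ s.nat 0 i 0 then
      (-1 + ∑ j ∈ Finset.range (N + 2), if 1 ≤ s.nat 0 j 0 then s.real 1 i j else 0) else 0)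
    (by simpa using h3) hm rfl rfl ⟨by simp [NExp.eval], by simp [NExp.eval, RExp.eval]⟩ ?_ ?_
  · rintro k s₁ hk h5 hF ⟨h13, hr⟩
    have h3₁ : s₁.var 3 = N + 2 := (hF.var 3 rfl).trans (by simpa using h3)
    have hn₁ : s₁.nat 0 = s.nat 0 := (hF.nat 0 rfl).trans rfl
    have hr₁ : s₁.real 1 = s.real 1 := (hF.real 1 rfl).trans (by funext i j; simp)
    refine wp_cond (fun h => ?_) fun h => wp_nop ?_ <;>
      simp only [BExp.Holds, NExp.eval, h5, hn₁] at h
    · have hone : s.nat 0 k 0 = 1 := by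
        rw [hS ⟨k, hk⟩, if_pos ((marked ⟨k, hk⟩).1 h)]
      refine wp_seq (wp_setVar (wp_seq (wp_setReal ?_)))
      refine wp_forLoop (fun l s' => s'.real 0 0 0 = s₁.real 0 0 0 + (-1 +
        ∑ j ∈ Finset.range l, if 1 ≤ s.nat 0 j 0 then s.real 1 k j else 0))
        (by simpa using h3₁) hm rfl rfl (by simp [NExp.eval, RExp.eval]; ring) ?_ ?_
      · intro l s₂ hl h6 hF₂ hJ
        have h5₂ : s₂.var 5 = k := (hF₂.var 5 rfl).trans (by simpa using h5)
        have hn₂ : s₂.nat 0 = s.nat 0 := (hF₂.nat 0 rfl).trans hn₁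
        have hr₂ : s₂.real 1 = s.real 1 :=
          (hF₂.real 1 rfl).trans (Eq.trans (by funext i j; simp) hr₁)
        refine wp_cond (fun h => wp_setReal ?_) fun h => wp_nop ?_ <;>
          simp only [BExp.Holds, NExp.eval, h6, hn₂] at h
        · simp [NExp.eval, RExp.eval, h5₂, h6, hr₂, hJ, Finset.sum_range_succ, h]
          ring
        · simp only [State.putVar_real, hJ, Finset.sum_range_succ, if_neg h, add_zero]
      · intro s₂ hF₂ hJ
        have h13₂ : s₂.var 13 = 1 - s₁.var 13 := (hF₂.var 13 rfl).trans (by simp [NExp.eval])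
        refine ⟨?_, ?_⟩
        · simp only [State.putVar_var, h13₂, h13, Finset.sum_range_succ, hone]
          simp
          omega
        · rw [State.putVar_real, hJ, hr, Finset.sum_range_succ (n := k), if_pos h, add_assoc]
    · have hzero : s.nat 0 k 0 = 0 := by omega
      refine ⟨?_, ?_⟩
      · simp [h13, Finset.sum_range_succ, hzero]
      · simp only [State.putVar_real, hr, Finset.sum_range_succ, if_neg h, add_zero]
  · rintro s₁ hF ⟨h13, hr⟩
    have h0₁ : s₁.var 0 = 0 := (hF.var 0 rfl).trans (by simpa using h0)
    have hcard : ∑ i ∈ Finset.range (N + 2), s.nat 0 i 0 = S.card := by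
      rw [Finset.sum_range]
      simp [hS]
    have hsum : s₁.real 0 0 0 = 1 - (S.card : ℝ) + ∑ u ∈ S, ∑ v ∈ S, y.pairWeight u v := by
      rw [hr, Finset.sum_range]
      simp only [Finset.sum_range, marked, hW]
      simp only [← Finset.sum_filter, Finset.filter_mem_eq_inter, Finset.univ_inter,
        Finset.sum_add_distrib]
      simp
      ring
    rw [hcard] at h13
    refine wp_cond (fun h => wp_setVar (Or.inl ?_)) fun h => wp_nop (Or.inr ?_) <;>
      simp only [BExp.Holds, NExp.eval, RExp.eval, not_le, hsum, h13] at h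
    · exact ⟨by simp [NExp.eval], Nat.odd_iff.2 (by omega), h.2⟩
    · refine ⟨h0₁, fun hodd => not_lt.1 fun hlt => h ⟨?_, hlt⟩⟩
      rw [Nat.odd_iff.1 hodd]

/-- Some minimal minimum cut around `a` that avoids `b` does not violate an odd-set constraint. -/
def CutSat (ell : Network N) (y : Point N) (a b : Fin (N + 2 + 1)) : Prop :=
  ∃ X S, IsMinCut (cut y.weight) a b X ∧ (lift S = X ∨ lift S = Xᶜ) ∧
    ∀ hS : Odd S.card, (Constraint.oddSet S hS).Sat ell y

/-- Once an answer exists the program is idle. This protects the recorded set, and it means that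
push-relabel runs only when `P`, hence nonnegativity of the weights, is known. -/
theorem wp_treatPair {P : Prop} {a b : Fin (N + 2 + 1)} (h3 : s.var 3 = N + 2)
    (h4 : s.var 4 = N + 3) (h7 : s.var 7 = a) (h8 : s.var 8 = b) (hm : roundBound (N + 3) ≤ m)
    (hP : P → ∀ u v, 0 ≤ y.weight u v) (hW : ∀ u v : Fin (N + 2 + 1), s.real 1 u v = y.weight u v)
    (hst : Status ell y P s)
    (done : ∀ s', Status ell y (P ∧ (a ≠ b → CutSat ell y b a)) s' → Q s') :
    WP m I treatPair s Q := by
  refine wp_cond (fun h => ?_) fun h => wp_nop (done s ?_) <;>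
    simp only [BExp.Holds, NExp.eval, h7, h8, ← le_antisymm_iff, Nat.le_zero] at h
  · obtain ⟨h0, hab⟩ := h
    have hab' : a ≠ b := fun h => hab (by rw [h])
    obtain ⟨_, hp⟩ := hst.resolve_left fun ⟨c, hc, _⟩ => hc.var_ne_zero h0
    have hmN : N + 2 ≤ m := le_trans (by rw [roundBound]; omega) hm
    refine wp_seq (wp_minCutProg (hP hp) y.weight_self y.weight_comm hab' h4 h7 h8 hW hm
      fun s₁ hF₁ hcut => wp_seq ?_)
    have h3₁ := (hF₁.var 3 rfl).trans h3
    have h4₁ := (hF₁.var 4 rfl).trans h4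
    have h0₁ := (hF₁.var 0 rfl).trans h0
    have h1₁ := hF₁.real 1 rfl
    -- The side of the cut without the extra vertex. Variable `3` holds `N + 2`, which is both the
    -- number of nodes and the index of that vertex.
    set S : Finset (Fin (N + 2)) := Finset.univ.filter fun v =>
      ¬ (s₁.nat 1 v 0 < N + 3 ↔ s₁.nat 1 (N + 2) 0 < N + 3) with hS
    have hlift : lift S = Finset.univ.filter (fun v : Fin (N + 2 + 1) => s₁.nat 1 v 0 < N + 3) ∨
        lift S = (Finset.univ.filter fun v : Fin (N + 2 + 1) => s₁.nat 1 v 0 < N + 3)ᶜ := by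
      by_cases hr : s₁.nat 1 (N + 2) 0 < N + 3
      · right
        ext v
        induction v using Fin.lastCases with
        | last => simp [last_notMem_lift, hr]
        | cast v => simp [castSucc_mem_lift, hS, hr]
      · left
        ext v
        induction v using Fin.lastCases with
        | last => simpa [last_notMem_lift] using hr
        | cast v => simp [castSucc_mem_lift, hS, hr]
    refine wp_forLoop (fun k s' => ∀ i < k, s'.nat 0 i 0 =
      if (s₁.nat 1 i 0 < N + 3 ↔ s₁.nat 1 (N + 2) 0 < N + 3) then 0 else 1) h3₁ hmN rfl rfl
      (by simp) ?_ ?_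
    · intro k s₂ hk h5 hF₂ hJ
      have h3₂ := (hF₂.var 3 rfl).trans h3₁
      have h4₂ := (hF₂.var 4 rfl).trans h4₁
      have h1₂ := hF₂.nat 1 rfl
      refine wp_cond (fun h => wp_cond (fun h' => wp_setNat ?_) fun h' => wp_setNat ?_)
        (fun h => wp_cond (fun h' => wp_setNat ?_) fun h' => wp_setNat ?_) <;>
      · simp only [BExp.Holds, NExp.eval, h3₂, h4₂, h5, h1₂, Nat.add_one_le_iff] at h h' ⊢
        intro i hi
        rcases Nat.lt_succ_iff_lt_or_eq.1 hi with hi | rfl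
        · simpa [hi.ne] using hJ i hi
        · simp [h, h']
    · intro s₂ hF₂ hJ
      have hmark : ∀ v : Fin (N + 2), s₂.nat 0 v 0 = if v ∈ S then 1 else 0 := by
        intro v
        rw [hJ v v.isLt]
        simp only [hS, Finset.mem_filter, Finset.mem_univ, true_and, ite_not]
      refine wp_testOddSet (y := y) ((hF₂.var 3 rfl).trans h3₁) hmN ((hF₂.var 0 rfl).trans h0₁) hmark ?_
        (fun s₃ hF₃ h9 hodd hlt => done _ (Or.inl ?_)) fun s₃ hF₃ h0₃ hle => done _ (Or.inr ?_)
      · intro u v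
        rw [hF₂.real 1 rfl, h1₁, ← y.weight_castSucc_castSucc]
        exact hW u.castSucc v.castSucc
      · refine ⟨.oddSet S hodd, ⟨h9, fun v => ?_⟩, ?_⟩
        · rw [hF₃.nat 0 rfl, hmark]
        · rw [Constraint.sat_oddSet_iff]
          exact hlt.not_ge
      · exact ⟨h0₃, hp, fun _ => ⟨_, S, hcut, hlift, fun hodd =>
          (Constraint.sat_oddSet_iff S hodd).2 (hle hodd)⟩⟩
  · rcases hst with hst | ⟨h0, hp⟩
    · exact Or.inl hst
    · exact Or.inr ⟨h0, hp, fun hab => absurd ⟨h0, fun h' => hab (Fin.ext h')⟩ h⟩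

theorem wp_checkOddSets {P : Prop} (h3 : s.var 3 = N + 2) (h4 : s.var 4 = N + 3)
    (hm : roundBound (N + 3) ≤ m) (hP : P → ∀ u v, 0 ≤ y.weight u v)
    (hW : ∀ u v : Fin (N + 2 + 1), s.real 1 u v = y.weight u v) (hst : Status ell y P s)
    (done : ∀ s', Status ell y (P ∧ ∀ S hS, (Constraint.oddSet S hS).Sat ell y) s' → Q s') :
    WP m I checkOddSets s Q := by
  have hmN : N + 3 ≤ m := le_trans (by rw [roundBound]; omega) hm
  -- The outer counter is the source and the inner one the sink, so the cut around `b` avoiding `a`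
  -- belongs to the pair `(a, b)`.
  refine wp_forLoop (fun k => Status ell y (P ∧ ∀ a b : Fin (N + 2 + 1), (a : ℕ) < k → a ≠ b →
    CutSat ell y b a)) h4 hmN rfl rfl ((hst.putVar (by simp)).imp fun h => ⟨h, by simp⟩) ?_
    fun s' _ h => done s' (h.imp fun h => ⟨h.1, sat_oddSet_of_minCuts (hP h.1) fun a b hab =>
      h.2 b a b.isLt hab.symm⟩)
  intro k s₁ hk h7 hF hJ
  have h4₁ := (hF.var 4 rfl).trans h4
  refine wp_forLoop (fun l => Status ell y ((P ∧ ∀ a b : Fin (N + 2 + 1), (a : ℕ) < k → a ≠ b →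
    CutSat ell y b a) ∧ ∀ b : Fin (N + 2 + 1), (b : ℕ) < l → (⟨k, hk⟩ : Fin (N + 2 + 1)) ≠ b →
      CutSat ell y b ⟨k, hk⟩)) h4₁ hmN rfl rfl
    ((hJ.putVar (by simp)).imp fun h => ⟨h, by simp⟩) ?_ ?_
  · intro l s₂ hl h8 hF₂ hJ₂
    refine wp_treatPair (a := ⟨k, hk⟩) (b := ⟨l, hl⟩)
      ((hF₂.var 3 rfl).trans ((hF.var 3 rfl).trans h3)) ((hF₂.var 4 rfl).trans h4₁)
      ((hF₂.var 7 rfl).trans h7) h8 hm (fun h => hP h.1.1) ?_ hJ₂ fun s' hs' =>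
      (hs'.putVar (by simp)).imp fun h => ⟨h.1.1, fun b hb hab => ?_⟩
    · intro u v
      rw [hF₂.real 1 rfl, hF.real 1 rfl, hW]
    · rcases Nat.lt_succ_iff_lt_or_eq.1 hb with hb | hb
      · exact h.1.2 b hb hab
      · obtain rfl : b = ⟨l, hl⟩ := Fin.ext hb
        exact h.2 hab
  · intro s₂ _ hJ₂
    refine (hJ₂.putVar (by simp)).imp fun h => ⟨h.1.1, fun a b ha hab => ?_⟩
    rcases Nat.lt_succ_iff_lt_or_eq.1 ha with ha | ha
    · exact h.1.2 a b ha hab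
    · obtain rfl : a = ⟨k, hk⟩ := Fin.ext ha
      exact h.2 b b.isLt hab

theorem wp_separation (ell : Network N) (y : Point N) :
    WP (roundBound (N + 3)) (input ell y) separation (start N) (Status ell y (Feasible ell y)) := by
  have hm : N + 2 ≤ roundBound (N + 3) := by rw [roundBound]; omega
  refine wp_seq (wp_seq (wp_setVar (wp_seq (wp_setVar (wp_setVar ?_)))))
  refine wp_seq (wp_checkLinks (P := True) (by simp [NExp.eval, start]) hm
    (Or.inr ⟨by simp [NExp.eval], trivial⟩) fun s₁ hF₁ h₁ => ?_)
  have h3₁ : s₁.var 3 = N + 2 := (hF₁.var 3 rfl).trans (by simp [NExp.eval, start])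
  have h4₁ : s₁.var 4 = N + 3 := (hF₁.var 4 rfl).trans (by simp [NExp.eval, start])
  refine wp_seq (wp_checkConservation h3₁ hm h₁ fun s₂ hF₂ h₂ => ?_)
  have h3₂ := (hF₂.var 3 rfl).trans h3₁
  have h4₂ := (hF₂.var 4 rfl).trans h4₁
  refine wp_seq (wp_checkDegrees h3₂ hm h₂ fun s₃ hF₃ h₃ hW => ?_)
  have h3₃ := (hF₃.var 3 rfl).trans h3₂
  have h4₃ := (hF₃.var 4 rfl).trans h4₂
  refine wp_checkOddSets h3₃ h4₃ le_rfl (fun h => Point.weight_nonneg h.1.1.1.2.lamHatNonneg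
    fun v => (Constraint.sat_degree_iff v).1 (h.2 v)) hW h₃ fun s₄ h₄ => h₄.imp ?_
  rintro ⟨⟨⟨⟨⟨_, hl⟩, hle⟩, hge⟩, hd⟩, hodd⟩ (⟨i, j⟩ | ⟨i, j⟩ | i | i | ⟨i, j, h⟩ | ⟨i, j, h⟩ |
    ⟨i, j⟩ | v | ⟨S, h⟩ | ⟨i, j, h⟩)
  exacts [hl.flowNonneg i j, hl.flowLe i j, hle i, hge i, hl.sumLe i j h, hl.sumGe i j h,
    hl.lamNonneg i j, hd v, hodd S h, hl.lamHatNonneg i j h]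

theorem exists_polynomial_roundBound :
    ∃ q : Polynomial ℕ, ∀ N, q.eval N = roundBound (N + 3) :=
  ⟨((.X + 3 + 1) * (.X + 3) + 2) * (.X + 3) ^ 2 + (.X + 3 + 1) * (.X + 3) ^ 2 + (.X + 3) ^ 2 + 1 +
    (.X + 3), fun N => by simp [roundBound]⟩

end specifications

end OneTwoOne

theorem theorem3 :
    ∃ (oracle : RealRAM.Prog) (p : Polynomial ℕ),
      ∀ (N : ℕ) (ell : OneTwoOne.Network N) (y : OneTwoOne.Point N),
        ∃ (t : ℕ) (s : RealRAM.State) (answer : Option (OneTwoOne.Constraint N)),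
          RealRAM.Exec (OneTwoOne.input ell y) oracle (OneTwoOne.start N) t s ∧
          t ≤ p.eval N ∧
          OneTwoOne.Answer s answer ∧
          (answer = none ↔ OneTwoOne.Feasible ell y) ∧
          (∀ c : OneTwoOne.Constraint N, answer = some c → ¬ c.Sat ell y) := by
  obtain ⟨p, hp⟩ := OneTwoOne.separation.exists_polynomial_bound
  obtain ⟨q, hq⟩ := OneTwoOne.exists_polynomial_roundBound
  -- `q` bounds the rounds of each loop in terms of `N`, and `p` turns this into a bound on the
  -- steps.
  refine ⟨OneTwoOne.separation, p.comp q, fun N ell y => ?_⟩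
  obtain ⟨t, s, hexec, ht, hst⟩ := OneTwoOne.wp_separation ell y
  rw [hp, ← hq, ← Polynomial.eval_comp] at ht
  rcases hst with ⟨c, hc, hsat⟩ | ⟨h0, hfeas⟩
  · refine ⟨t, s, some c, hexec, ht, hc, ⟨by simp, fun h => absurd (h c) hsat⟩,
      fun _ h => Option.some.inj h ▸ hsat⟩
  · exact ⟨t, s, none, hexec, ht, h0, by simp [hfeas], by simp⟩
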